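/- **Definitions.** Let $\mu=(n_i)_{i\in I}$ be a finite signature ($I$ finite). A relational structure $R=(V,(\rho_i)_{i\in I})$ of signature $\mu$ consists of a set $V$ and an $n_i$-ary relation $\rho_i$ on $V$ for each $i\in I$; it is *ordered* if one of its relations $\rho_i$ is a (reflexive) linear order on $V$. A subset $B\subseteq V$ is a *monomorphic block* of $R$ if any two finite subsets $A,A'$ of $V$ with $|A|=|A'|$ and $A\setminus B=A'\setminus B$ induce isomorphic structures. A *monomorphic decomposition* of $R$ is a partition of $V$ into monomorphic blocks; it is finite if it has finitely many blocks. A *monomorphic component* of $R$ is a monomorphic block that is maximal for inclusion. The *age* $\mathcal A(R)$ is the class of finite structures that embed into $R$ (as induced substructures). A class of finite structures is *hereditary* if it contains every structure that embeds into one of its members. The *profile* of a class $\mathscr C$ of finite structures is the function $\varphi_{\mathscr C}$ where $\varphi_{\mathscr C}(n)$ is the number of members of $\mathscr C$ with $n$ elements, counted up to isomorphism. A function $\varphi:\mathbb N\to\mathbb N$ is *eventually a quasi-polynomial* if there are $k\ge 0$ and periodic functions $a_0,\dots,a_k:\mathbb N\to\mathbb Q$ such that $\varphi(n)=a_k(n)n^k+\dots+a_0(n)$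 for all sufficiently large $n$; it is *at least exponential* if there is a real number $c>1$ such that $\varphi(n)\ge c^n$ for all sufficiently large $n$. **Theorem.** Let $\mu$ be a finite signature. (a) Let $R$ be an ordered relational structure of signature $\mu$. If $R$ has a finite monomorphic decomposition, then the profile of $\mathcal A(R)$ is eventually a quasi-polynomial; otherwise the profile of $\mathcal A(R)$ is at least exponential. (b) Let $\mathscr C$ be a hereditary class of finite ordered relational structures of signature $\mu$. Then either the number of monomorphic components of the members of $\mathscr C$ is uniformly bounded and the profile of $\mathscr C$ is eventually a quasi-polynomial, or this number is not uniformly bounded and the profile of $\mathscr C$ is at least exponential. Consequently, if the profile of $\mathscr C$ is not bounded above by a polynomial, it is at least exponential. -/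

import Mathlib

open CategoryTheory
open scoped FirstOrder

universe u v w

namespace OrderedProfile


section Structures

variable (L : FirstOrder.Language.{u, v}) [L.IsRelational]

/-- The structure induced by a relational structure `M` on a subset `A` of its domain. -/
def induced {M : Type w} [L.Structure M] (A : Set M) : L.Substructure M where
  carrier := A
  fun_mem := fun f => isEmptyElim f

/-- `B` is a monomorphic block: any two finite subsets `A`, `A'` with the same number of elements
which agree outside `B` induce isomorphic structures. -/
def IsMonomorphicBlock {M : Type w} [L.Structure M] (B : Set M) : Prop :=
  ∀ A A' : Finset M, A.card = A'.card → (A : Set M) \ B = (A' : Set M) \ B →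
    Nonempty (induced L (A : Set M) ≃[L] induced L (A' : Set M))

/-- A monomorphic decomposition is a partition of the domain into monomorphic blocks. -/
def IsMonomorphicDecomposition {M : Type w} [L.Structure M] (P : Set (Set M)) : Prop :=
  Setoid.IsPartition P ∧ ∀ B ∈ P, IsMonomorphicBlock L B

/-- `M` has a monomorphic decomposition with finitely many blocks. -/
def HasFiniteMonomorphicDecomposition (M : Type w) [L.Structure M] : Prop :=
  ∃ P : Set (Set M), P.Finite ∧ IsMonomorphicDecomposition L P

/-- The monomorphic components: the monomorphic blocks that are maximal for inclusion. -/
def monomorphicComponents (M : Type w) [L.Structure M] : Set (Set M) :=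
  {B | Maximal (IsMonomorphicBlock L) B}

/-- There is a finite bound on the numbers of monomorphic components of the members of `C`. -/
def BoundedComponents (C : Set (Bundled.{w} L.Structure)) : Prop :=
  ∃ N : ℕ, ∀ M ∈ C, (monomorphicComponents L M).encard ≤ N

end Structures

section Ordered

variable (L : FirstOrder.Language.{u, v})

/-- A structure is ordered if one of its binary relations is a (reflexive) linear order. -/
def IsOrdered (M : Type w) [L.Structure M] : Prop :=
  ∃ r : L.Relations 2,
    (∀ a : M, FirstOrder.Language.Structure.RelMap r ![a, a]) ∧
    (∀ a b c : M, FirstOrder.Language.Structure.RelMap r ![a, b] → FirstOrder.Language.Structure.RelMap r ![b, c] →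
      FirstOrder.Language.Structure.RelMap r ![a, c]) ∧
    (∀ a b : M, FirstOrder.Language.Structure.RelMap r ![a, b] → FirstOrder.Language.Structure.RelMap r ![b, a] →
      a = b) ∧
    (∀ a b : M, FirstOrder.Language.Structure.RelMap r ![a, b] ∨ FirstOrder.Language.Structure.RelMap r ![b, a])

/-- The profile of a class: the number of members with exactly `n` elements, counted up to
isomorphism. (This is a genuine count, as the number is finite for a finite relational
signature: see `finite_isoClasses`.) -/
noncomputable def profile (C : Set (Bundled.{w} L.Structure)) (n : ℕ) : ℕ :=
  (Quotient.mk (FirstOrder.Language.equivSetoid (L := L)) '' {M ∈ C | Finite M ∧ Nat.card M = n}).ncard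

theorem finite_isoClasses [L.IsRelational] [Finite (Σ n, L.Relations n)]
    (C : Set (Bundled.{w} L.Structure)) (n : ℕ) :
    (Quotient.mk (FirstOrder.Language.equivSetoid (L := L)) ''
      {M ∈ C | Finite M ∧ Nat.card M = n}).Finite := by
  classical
  let T := ULift.{w} (Fin n)
  let F : ((p : Σ k, L.Relations k) → Set (Fin p.1 → T)) →
      Quotient (FirstOrder.Language.equivSetoid (L := L)) := fun g =>
    Quotient.mk _ (⟨T, { funMap := fun f => isEmptyElim f
                         RelMap := fun {k} r x => x ∈ g ⟨k, r⟩ }⟩ : Bundled.{w} L.Structure)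
  refine (Set.finite_range F).subset ?_
  rintro _ ⟨M, ⟨-, hfin, hcard⟩, rfl⟩
  let e : M ≃ T := (Finite.equivFinOfCardEq hcard).trans Equiv.ulift.symm
  refine ⟨fun p => {x | FirstOrder.Language.Structure.RelMap p.2 (fun i => e.symm (x i))}, ?_⟩
  refine Quotient.sound ⟨?_⟩
  letI : L.Structure T :=
    { funMap := fun f => isEmptyElim f
      RelMap := fun {k} r x => FirstOrder.Language.Structure.RelMap r (fun i => e.symm (x i)) }
  exact
    { e.symm with
      map_fun' := fun f => isEmptyElim f
      map_rel' := fun r x => Iff.rfl }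

end Ordered

section Growth

/-- From some rank on, `f n = a_k(n) n ^ k + ⋯ + a_0(n)` with periodic coefficients `a_i`. -/
def EventuallyQuasiPolynomial (f : ℕ → ℕ) : Prop :=
  ∃ (k : ℕ) (a : ℕ → ℕ → ℚ),
    (∀ i, ∃ p : ℕ, 0 < p ∧ Function.Periodic (a i) p) ∧
    ∀ᶠ n : ℕ in Filter.atTop, (f n : ℚ) = ∑ i ∈ Finset.range (k + 1), a i n * (n : ℚ) ^ i

/-- `f n ≥ c ^ n` for all large `n`, for some real number `c > 1`. -/
def AtLeastExponential (f : ℕ → ℕ) : Prop :=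
  ∃ c : ℝ, 1 < c ∧ ∀ᶠ n : ℕ in Filter.atTop, c ^ n ≤ (f n : ℝ)

/-- `f` is bounded above by a polynomial. -/
def PolynomiallyBounded (f : ℕ → ℕ) : Prop :=
  ∃ p : Polynomial ℝ, ∀ n : ℕ, (f n : ℝ) ≤ p.eval (n : ℝ)

end Growth

end OrderedProfile

/-! Call two points interchangeable if replacing one by the other in any finite set never changes
the isomorphism type. This is an equivalence relation, and a set is a monomorphic block exactly when
its points are pairwise interchangeable (`isMonomorphicBlock_iff`), so the components are the
classes.

In a finite ordered structure one counts breaks instead: points not interchangeable with their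
successor. Isomorphisms between finite subsets are forced by the order, so a break is witnessed by
one tuple, hence by at most `m` further points, where `m` bounds the arities. Breaks and components
are bounded together: cutting after each break leaves intervals that are blocks
(`exists_isCanonicalColoring`), and a pigeonhole argument bounds the breaks in terms of the
components (`ncard_breaks_le`).

If breaks are unbounded, one picks `h` independent ones, with `h` proportional to `n`. Moving any
subset of them to their successors yields `2 ^ h` pairwise non-isomorphic structures on `n` points
(`two_pow_le_profile`).

If breaks are bounded, a member is coded by the sizes of its intervals and by one of finitely many
patterns. The size vectors sharing a pattern form an order-convex subset of `Fin K → ℕ`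
(`HasCode.exists_induced`), that is, a difference of two lower sets. By well-quasi-ordering the
vectors of sum `n` in it are eventually counted by a polynomial (`eventuallyPolynomial_sumCount`).
So the profile is eventually a genuine polynomial. For a single structure, a finite decomposition
exists exactly when the age has boundedly many components. -/

namespace OrderedProfile

open FirstOrder.Language FirstOrder.Language.Structure

/-! ### Interchangeable points and monomorphic blocks -/

section Interchange

variable (L : FirstOrder.Language.{u, v}) {M : Type w} [L.Structure M]

/-- `g` restricts to an isomorphism from the structure induced on `A` to the one induced on
`A'`. -/
def IsoOn (A A' : Set M) (g : M → M) : Prop :=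
  Set.BijOn g A A' ∧ ∀ (k : ℕ) (R : L.Relations k) (t : Fin k → M), (∀ i, t i ∈ A) →
    (RelMap R (g ∘ t) ↔ RelMap R t)

/-- `A` and `A'` induce isomorphic structures. -/
def SameType (A A' : Set M) : Prop := ∃ g : M → M, IsoOn L A A' g

/-- `x` and `y` can be exchanged in every finite subset without changing its isomorphism type. -/
def Interchangeable (x y : M) : Prop :=
  ∀ F : Set M, F.Finite → x ∉ F → y ∉ F → SameType L (insert x F) (insert y F)

variable {L}

theorem SameType.refl (A : Set M) : SameType L A A :=
  ⟨id, Set.bijOn_id A, fun _ _ _ _ => Iff.rfl⟩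

theorem SameType.trans {A B C : Set M} (h : SameType L A B) (h' : SameType L B C) :
    SameType L A C := by
  obtain ⟨g, hg, hR⟩ := h
  obtain ⟨g', hg', hR'⟩ := h'
  refine ⟨g' ∘ g, hg'.comp hg, fun k R t ht => ?_⟩
  rw [Function.comp_assoc, hR' k R (g ∘ t) fun i => hg.mapsTo (ht i), hR k R t ht]

theorem SameType.symm {A B : Set M} (h : SameType L A B) : SameType L B A := by
  obtain ⟨g, hg, hR⟩ := h
  rcases isEmpty_or_nonempty M with hM | hM
  · exact ⟨g, by obtain rfl := Subsingleton.elim A B; exact hg,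
      fun k R t ht => by rw [Subsingleton.elim (g ∘ t) t]⟩
  · have hi := hg.invOn_invFunOn
    refine ⟨Function.invFunOn g A, hg.symm hi.symm, fun k R t ht => ?_⟩
    have hm : ∀ i, (Function.invFunOn g A ∘ t) i ∈ A := fun i => (hg.symm hi.symm).mapsTo (ht i)
    rw [← hR k R _ hm]
    have : g ∘ Function.invFunOn g A ∘ t = t := funext fun i => hi.2 (ht i)
    rw [this]

theorem sameType_iff [L.IsRelational] {A A' : Set M} :
    SameType L A A' ↔ Nonempty (induced L A ≃[L] induced L A') := by
  classical
  constructor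
  · rintro ⟨g, hg, hR⟩
    exact ⟨{ toEquiv := hg.equiv g
             map_fun' := fun f => isEmptyElim f
             map_rel' := fun {k} R t => hR k R (fun i => (t i : M)) fun i => (t i).2 }⟩
  · rintro ⟨e⟩
    let g : M → M := fun z => if h : z ∈ A then (e ⟨z, h⟩ : M) else z
    have hgz : ∀ z (h : z ∈ A), g z = (e ⟨z, h⟩ : M) := fun z h => dif_pos h
    refine ⟨g, ⟨fun z hz => ?_, fun z hz w hw h => ?_, fun w hw => ?_⟩, fun k R t ht => ?_⟩
    · rw [hgz z hz]; exact (e ⟨z, hz⟩).2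
    · rw [hgz z hz, hgz w hw] at h
      exact congrArg Subtype.val (e.injective (Subtype.ext h))
    · refine ⟨(e.symm ⟨w, hw⟩ : M), (e.symm ⟨w, hw⟩).2, ?_⟩
      rw [hgz _ (e.symm ⟨w, hw⟩).2]
      simp
    · have := e.map_rel R (fun i => (⟨t i, ht i⟩ : induced L A))
      rw [show g ∘ t = fun i => ((e ⟨t i, ht i⟩ : induced L A') : M) from
        funext fun i => hgz _ (ht i)]
      exact this

theorem SameType.image {N : Type w} [L.Structure N] [L.IsRelational] (e : M ↪[L] N) {A A' : Set M}
    (h : SameType L A A') : SameType L (e '' A) (e '' A') := by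
  classical
  obtain ⟨g, hg, hR⟩ := h
  refine ⟨Function.extend e (e ∘ g) id, ?_, fun k R t ht => ?_⟩
  · have hx : ∀ z, Function.extend e (e ∘ g) id (e z) = e (g z) := fun z =>
      e.injective.extend_apply _ _ z
    refine ⟨?_, ?_, ?_⟩
    · rintro _ ⟨z, hz, rfl⟩
      exact ⟨g z, hg.mapsTo hz, (hx z).symm⟩
    · rintro _ ⟨z, hz, rfl⟩ _ ⟨w, hw, rfl⟩ h
      rw [hx, hx] at h
      rw [hg.injOn hz hw (e.injective h)]
    · rintro _ ⟨w, hw, rfl⟩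
      obtain ⟨z, hz, rfl⟩ := hg.surjOn hw
      exact ⟨e z, ⟨z, hz, rfl⟩, hx z⟩
  · choose s hs hst using ht
    obtain rfl : e ∘ s = t := funext hst
    rw [e.map_rel, ← hR k R s hs, ← e.map_rel]
    congr! 1
    exact funext fun i => e.injective.extend_apply _ _ (s i)

theorem SameType.of_image {N : Type w} [L.Structure N] [L.IsRelational] (e : M ↪[L] N)
    {A A' : Set M} (h : SameType L (e '' A) (e '' A')) : SameType L A A' := by
  classical
  obtain ⟨g, hg, hR⟩ := h
  have : ∀ z, ∃ w, z ∈ A → w ∈ A' ∧ e w = g (e z) := fun z => by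
    by_cases hz : z ∈ A
    · obtain ⟨w, hw, h⟩ := hg.mapsTo (Set.mem_image_of_mem e hz)
      exact ⟨w, fun _ => ⟨hw, h⟩⟩
    · exact ⟨z, fun h => absurd h hz⟩
  choose f hf using this
  refine ⟨f, ⟨fun z hz => (hf z hz).1, fun z hz w hw h => ?_, fun w hw => ?_⟩,
    fun k R t ht => ?_⟩
  · refine e.injective (hg.injOn ⟨z, hz, rfl⟩ ⟨w, hw, rfl⟩ ?_)
    rw [← (hf z hz).2, ← (hf w hw).2, h]
  · obtain ⟨_, ⟨z, hz, rfl⟩, h⟩ := hg.surjOn (Set.mem_image_of_mem e hw)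
    exact ⟨z, hz, e.injective ((hf z hz).2.trans h)⟩
  · rw [← e.map_rel, ← e.map_rel R t, ← hR k R (e ∘ t) fun i => ⟨t i, ht i, rfl⟩]
    congr! 1
    exact funext fun i => (hf _ (ht i)).2

namespace Interchangeable

theorem refl (x : M) : Interchangeable L x x := fun _ _ _ _ => SameType.refl _

theorem symm {x y : M} (h : Interchangeable L x y) : Interchangeable L y x :=
  fun F hF hy hx => (h F hF hx hy).symm

theorem trans {x y z : M} (h : Interchangeable L x y) (h' : Interchangeable L y z) :
    Interchangeable L x z := by
  intro F hF hx hz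
  by_cases hy : y ∈ F
  · rcases eq_or_ne x z with rfl | hxz
    · exact SameType.refl _
    have hyx : y ≠ x := by rintro rfl; exact hx hy
    have hyz : y ≠ z := by rintro rfl; exact hz hy
    have hF' : insert y (F \ {y}) = F := Set.insert_sdiff_self_of_mem hy
    have hfin : (F \ {y}).Finite := hF.subset Set.sdiff_subset
    -- When `y` lies in `F`, write `F = F' ∪ {y}`: replace `y` by `z` beside `x`, then `x` by `y`
    -- beside `z`.
    have h1 := h' (insert x (F \ {y})) (hfin.insert _) (by simp [hyx]) (by simp [hxz.symm, hz])
    have h2 := h (insert z (F \ {y})) (hfin.insert _) (by simp [hxz, hx]) (by simp [hyz])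
    rw [Set.insert_comm, hF'] at h1
    rw [Set.insert_comm, Set.insert_comm y, hF'] at h2
    exact h1.trans h2
  · exact (h F hF hx hy).trans (h' F hF hy hz)

theorem of_embedding [L.IsRelational] {N : Type w} [L.Structure N] (e : M ↪[L] N) {x y : M}
    (h : Interchangeable L (e x) (e y)) : Interchangeable L x y := by
  intro F hF hx hy
  have := h (e '' F) (hF.image e) (by simpa [e.injective.eq_iff] using hx)
    (by simpa [e.injective.eq_iff] using hy)
  rw [← Set.image_insert_eq, ← Set.image_insert_eq] at this
  exact this.of_image e

theorem iff_of_equiv [L.IsRelational] {N : Type w} [L.Structure N] (e : M ≃[L] N) {x y : M} :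
    Interchangeable L (e x) (e y) ↔ Interchangeable L x y := by
  refine ⟨fun h => of_embedding e.toEmbedding h, fun h => ?_⟩
  refine of_embedding e.symm.toEmbedding ?_
  simpa using h

/-- Used in contrapositive form: non-interchangeability yields a single tuple whose relation changes
when `x` becomes `y`, so the witness size is bounded by the arity. -/
theorem of_relMap [DecidableEq M] {x y : M}
    (h : ∀ (k : ℕ) (R : L.Relations k) (t : Fin k → M), (∀ i, t i ≠ y) →
      (RelMap R (Function.update id x y ∘ t) ↔ RelMap R t)) : Interchangeable L x y := by
  intro F hF hx hy
  rcases eq_or_ne x y with rfl | hxy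
  · exact SameType.refl _
  have h0 : ∀ z ∈ F, Function.update id x y z = z := fun z hz => by
    rw [Function.update_of_ne (by rintro rfl; exact hx hz)]; rfl
  have h1 : Function.update id x y x = y := Function.update_self ..
  refine ⟨Function.update id x y, ⟨?_, ?_, ?_⟩, fun k R t ht => ?_⟩
  · rintro z (rfl | hz)
    · rw [h1]; exact Set.mem_insert _ _
    · rw [h0 z hz]; exact Set.mem_insert_of_mem _ hz
  · rintro z (rfl | hz) w (rfl | hw) h
    · rfl
    · rw [h1, h0 w hw] at h; exact absurd (h ▸ hw) hy
    · rw [h1, h0 z hz] at h; exact absurd (h ▸ hz) hy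
    · rwa [h0 z hz, h0 w hw] at h
  · rintro z (rfl | hz)
    · exact ⟨x, Set.mem_insert _ _, h1⟩
    · exact ⟨z, Set.mem_insert_of_mem _ hz, h0 z hz⟩
  · refine h k R t fun i hi => ?_
    rcases ht i with h' | h'
    · exact hxy (h'.symm.trans hi)
    · exact hy (hi ▸ h')

end Interchangeable

/-- Two finite sets meeting the classes of interchangeable elements in equally many elements have
the same type. -/
theorem SameType.of_ncard_fiber {ι : Type*} {c : M → ι}
    (hc : ∀ x y, c x = c y → Interchangeable L x y) {A A' : Set M} (hA : A.Finite)
    (hA' : A'.Finite) (h : ∀ i, (A ∩ c ⁻¹' {i}).ncard = (A' ∩ c ⁻¹' {i}).ncard) :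
    SameType L A A' := by
  induction hn : (A \ A').ncard generalizing A with
  | zero =>
    have hsub : A ⊆ A' := by
      rwa [Set.ncard_eq_zero (hA.subset Set.sdiff_subset), Set.sdiff_eq_empty] at hn
    have : A = A' := by
      refine hsub.antisymm fun z hz => ?_
      have := Set.eq_of_subset_of_ncard_le (Set.inter_subset_inter_left (c ⁻¹' {c z}) hsub)
        (h (c z)).ge (hA'.subset Set.inter_subset_left)
      exact (this.ge ⟨hz, rfl⟩ : z ∈ A ∩ c ⁻¹' {c z}).1
    rw [this]; exact SameType.refl _
  | succ n ih =>
    obtain ⟨a, ha, ha'⟩ : (A \ A').Nonempty := by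
      rw [← Set.ncard_pos (hA.subset Set.sdiff_subset)]; omega
    -- Equal fibre counts provide a point `b` of `A' \ A` with the colour of `a`; trading `a` for
    -- `b` shrinks `A \ A'`.
    obtain ⟨b, hb, hbc, hbA⟩ : ∃ b ∈ A', c b = c a ∧ b ∉ A := by
      by_contra! hcon
      have hss : A' ∩ c ⁻¹' {c a} ⊂ A ∩ c ⁻¹' {c a} := by
        refine ⟨fun z hz => ⟨hcon z hz.1 hz.2, hz.2⟩, fun hs =>
          ha' (hs (⟨ha, rfl⟩ : a ∈ A ∩ c ⁻¹' {c a})).1⟩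
      have := Set.ncard_lt_ncard hss (hA.subset Set.inter_subset_left)
      have := h (c a)
      omega
    have hab : a ≠ b := by rintro rfl; exact hbA ha
    have hfin : (A \ {a}).Finite := hA.subset Set.sdiff_subset
    have h1 := hc a b hbc.symm (A \ {a}) hfin (by simp) (by simp [hbA])
    rw [Set.insert_sdiff_self_of_mem ha] at h1
    refine h1.trans (ih (hfin.insert b) (fun i => ?_) ?_)
    · rw [← h i]
      by_cases hi : c a = i
      · have h2 : insert b (A \ {a}) ∩ c ⁻¹' {i} = insert b ((A ∩ c ⁻¹' {i}) \ {a}) := by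
          ext z; simp only [Set.mem_inter_iff, Set.mem_insert_iff, Set.mem_sdiff,
            Set.mem_singleton_iff, Set.mem_preimage]
          constructor
          · rintro ⟨rfl | h, h'⟩ <;> tauto
          · rintro (rfl | h)
            · exact ⟨Or.inl rfl, hbc.trans hi⟩
            · tauto
        rw [h2, Set.ncard_insert_of_notMem (by simp [hbA])
          ((hA.subset Set.inter_subset_left).subset Set.sdiff_subset),
          Set.ncard_sdiff_singleton_add_one (show a ∈ A ∩ c ⁻¹' {i} from ⟨ha, hi⟩)
            (hA.subset Set.inter_subset_left)]
      · congr 1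
        ext z; simp only [Set.mem_inter_iff, Set.mem_insert_iff, Set.mem_sdiff,
            Set.mem_singleton_iff, Set.mem_preimage]
        constructor
        · rintro ⟨rfl | h, h'⟩
          · exact absurd (hbc.symm.trans h') hi
          · tauto
        · rintro ⟨h1, h2⟩
          exact ⟨Or.inr ⟨h1, by rintro rfl; exact hi h2⟩, h2⟩
    · have h2 : insert b (A \ {a}) \ A' = (A \ A') \ {a} := by
        ext z; simp only [Set.mem_insert_iff, Set.mem_sdiff, Set.mem_singleton_iff]
        constructor
        · rintro ⟨rfl | h, h'⟩ <;> tauto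
        · tauto
      rw [h2]
      have := Set.ncard_sdiff_singleton_add_one (s := A \ A') ⟨ha, ha'⟩
        (hA.subset Set.sdiff_subset)
      omega

section Blocks

variable [L.IsRelational]

theorem isMonomorphicBlock_iff {B : Set M} :
    IsMonomorphicBlock L B ↔ ∀ x ∈ B, ∀ y ∈ B, Interchangeable L x y := by
  classical
  constructor
  · intro h x hx y hy F hF hxF hyF
    have := h (insert x hF.toFinset) (insert y hF.toFinset)
      (by rw [Finset.card_insert_of_notMem (by simpa), Finset.card_insert_of_notMem (by simpa)])
      (by simp only [Finset.coe_insert, Set.Finite.coe_toFinset]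
          rw [Set.insert_sdiff_of_mem _ hx, Set.insert_sdiff_of_mem _ hy])
    rw [← sameType_iff] at this
    simpa using this
  · intro h A A' hcard hAB
    rw [← sameType_iff]
    -- All of `B` gets one colour and every other point its own.
    refine SameType.of_ncard_fiber (c := fun z => if z ∈ B then none else some z) ?_
      A.finite_toSet A'.finite_toSet ?_
    · intro x y hxy
      split_ifs at hxy with h1 h2
      · exact h x h1 y h2
      · obtain rfl : x = y := by simpa using hxy
        exact Interchangeable.refl x
    · have hB : ∀ A : Finset M, (A : Set M) ∩ (fun z => if z ∈ B then none else some z) ⁻¹' {none}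
          = (A : Set M) ∩ B := fun A => by ext z; by_cases hz : z ∈ B <;> simp [hz]
      have hs : ∀ (A : Finset M) (i : M),
          (A : Set M) ∩ (fun z => if z ∈ B then none else some z) ⁻¹' {some i}
          = ((A : Set M) \ B) ∩ {i} := fun A i => by
        ext z; by_cases hz : z ∈ B <;> simp [hz]
      rintro (_ | i)
      · rw [hB, hB]
        have e1 := Set.ncard_inter_add_ncard_sdiff_eq_ncard (A : Set M) B A.finite_toSet
        have e2 := Set.ncard_inter_add_ncard_sdiff_eq_ncard (A' : Set M) B A'.finite_toSet
        rw [Set.ncard_coe_finset] at e1 e2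
        rw [hAB] at e1
        omega
      · rw [hs, hs, hAB]

variable (L M) in
/-- The equivalence relation whose classes are the monomorphic components. -/
def interchangeSetoid : Setoid M where
  r := Interchangeable L
  iseqv := ⟨Interchangeable.refl, Interchangeable.symm, Interchangeable.trans⟩

theorem setOf_interchangeable_mem_monomorphicComponents (x : M) :
    {y | Interchangeable L x y} ∈ monomorphicComponents L M := by
  refine ⟨isMonomorphicBlock_iff.2 fun y hy z hz => hy.symm.trans hz, fun B hB hle y hy => ?_⟩
  exact isMonomorphicBlock_iff.1 hB x (hle (Interchangeable.refl x)) y hy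

theorem encard_interchange_quotient_le :
    ENat.card (Quotient (interchangeSetoid L M)) ≤ (monomorphicComponents L M).encard := by
  let f : Quotient (interchangeSetoid L M) → Set M := fun q => {y | Quotient.mk _ y = q}
  have hf : Function.Injective f := fun p q h => by
    induction p using Quotient.inductionOn with
    | _ x => exact (h ▸ rfl : x ∈ f q)
  have : Set.range f ⊆ monomorphicComponents L M := by
    rintro _ ⟨q, rfl⟩
    induction q using Quotient.inductionOn with
    | _ x =>
      convert setOf_interchangeable_mem_monomorphicComponents (L := L) x using 1
      ext y
      exact ⟨fun h => (Quotient.exact h).symm, fun h => Quotient.sound (Interchangeable.symm h)⟩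
  calc ENat.card (Quotient (interchangeSetoid L M)) = (Set.range f).encard := by
        rw [← Set.image_univ, hf.encard_image, Set.encard_univ]
    _ ≤ _ := Set.encard_le_encard this

theorem exists_coloring_of_encard_monomorphicComponents_le {N : ℕ}
    (h : (monomorphicComponents L M).encard ≤ N) :
    ∃ c : M → Fin N, ∀ x y, c x = c y → Interchangeable L x y := by
  have h1 := encard_interchange_quotient_le.trans h
  have hfin : Finite (Quotient (interchangeSetoid L M)) := by
    rw [← ENat.card_lt_top]; exact h1.trans_lt (ENat.natCast_lt_top N)
  rw [ENat.card_eq_coe_natCard, Nat.cast_le] at h1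
  let e := Finite.equivFin (Quotient (interchangeSetoid L M))
  exact ⟨fun x => Fin.castLE h1 (e (Quotient.mk _ x)), fun x y hxy =>
    Quotient.exact (e.injective (Fin.castLE_injective h1 hxy))⟩

/-- The extra unit makes room for the empty block, which is maximal when the structure is empty; it
receives the value `none`. -/
theorem encard_monomorphicComponents_le_of_coloring {N : ℕ} {c : M → Fin N}
    (hc : ∀ x y, c x = c y → Interchangeable L x y) :
    (monomorphicComponents L M).encard ≤ (N + 1 : ℕ) := by
  classical
  let g : Set M → Option (Fin N) := fun B => if h : B.Nonempty then some (c h.some) else none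
  have hinj : Set.InjOn g (monomorphicComponents L M) := by
    intro B hB B' hB' h
    by_cases h1 : B.Nonempty <;> by_cases h2 : B'.Nonempty <;> simp only [g, h1, h2, dif_pos,
      dif_neg, not_false_eq_true, Option.some.injEq, reduceCtorEq] at h
    · have hE := hc _ _ h
      have aux : ∀ {B : Set M}, B ∈ monomorphicComponents L M → ∀ x ∈ B,
          B = {y | Interchangeable L x y} := fun {B} hB x hx =>
        hB.eq_of_subset (setOf_interchangeable_mem_monomorphicComponents x).prop
          fun y hy => isMonomorphicBlock_iff.1 hB.prop x hx y hy
      rw [aux hB _ h1.some_mem, aux hB' _ h2.some_mem]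
      ext y
      exact ⟨fun h => hE.symm.trans h, fun h => hE.trans h⟩
    · rw [Set.not_nonempty_iff_eq_empty] at h1 h2
      rw [h1, h2]
  rw [← hinj.encard_image]
  refine (Set.encard_le_encard (Set.subset_univ _)).trans ?_
  rw [Set.encard_univ, ENat.card_eq_coe_natCard]
  simp

end Blocks

end Interchange

/-- Source of all rigidity below: an isomorphism between finite ordered structures is determined by
its domain and image. -/
theorem eqOn_of_strictMonoOn_of_image_eq {α β : Type*} [LinearOrder α] [PartialOrder β]
    {A : Set α} (hA : A.Finite) {f g : α → β} (hf : StrictMonoOn f A) (hg : StrictMonoOn g A)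
    (h : f '' A = g '' A) : Set.EqOn f g A := by
  have : Finite A := hA
  have hf' : StrictMono (A.domRestrict f) := fun x y hxy => hf x.2 y.2 hxy
  have hg' : StrictMono (A.domRestrict g) := fun x y hxy => hg x.2 y.2 hxy
  have := (hf'.range_inj hg').1 (by rw [Set.range_domRestrict, Set.range_domRestrict, h])
  exact Set.domRestrict_eq_domRestrict_iff.1 this

/-! ### Bounding breaks by components -/

section Breaks

variable {L : FirstOrder.Language.{u, v}} {M : Type w} [L.Structure M] [LinearOrder M]

/-- The symbol `r` is interpreted by the order of `M`. -/
def InterpretsLE (M : Type w) [L.Structure M] [LinearOrder M] (r : L.Relations 2) : Prop :=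
  ∀ a b : M, RelMap r ![a, b] ↔ a ≤ b

theorem IsoOn.strictMonoOn {r : L.Relations 2} (hr : InterpretsLE M r) {A A' : Set M} {g : M → M}
    (h : IsoOn L A A' g) : StrictMonoOn g A := by
  intro a ha b hb hab
  have := (h.2 2 r ![a, b] (fun i => by fin_cases i <;> simpa)).2 ((hr a b).2 hab.le)
  rw [show g ∘ ![a, b] = ![g a, g b] from funext fun i => by fin_cases i <;> rfl] at this
  exact lt_of_le_of_ne ((hr _ _).1 this) fun h' => hab.ne (h.1.injOn ha hb h')

/-- The order isomorphism is the only possible isomorphism between finite subsets of an ordered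
structure. -/
theorem SameType.isoOn {r : L.Relations 2} (hr : InterpretsLE M r) {A A' : Set M} (hA : A.Finite)
    (h : SameType L A A') {θ : M → M} (hθ : StrictMonoOn θ A) (hθA : θ '' A = A') :
    IsoOn L A A' θ := by
  obtain ⟨g, hg⟩ := h
  have hgθ := eqOn_of_strictMonoOn_of_image_eq hA (hg.strictMonoOn hr) hθ
    (hg.1.image_eq.trans hθA.symm)
  refine ⟨hg.1.congr hgθ, fun k R t ht => ?_⟩
  rw [← hg.2 k R t ht]
  congr! 1
  exact funext fun i => (hgθ (ht i)).symm

theorem strictMonoOn_update_of_covBy {x y : M} (h : x ⋖ y) {A : Set M} (hy : y ∉ A) :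
    StrictMonoOn (Function.update id x y) A := by
  intro a ha b hb hab
  have hby : b ≠ y := by rintro rfl; exact hy hb
  rcases eq_or_ne a x with rfl | hax
  · rw [Function.update_self, Function.update_of_ne hab.ne']
    exact lt_of_le_of_ne (h.ge_of_gt hab) hby.symm
  · rw [Function.update_of_ne hax]
    rcases eq_or_ne b x with rfl | hbx
    · rw [Function.update_self]; exact hab.trans h.lt
    · rwa [Function.update_of_ne hbx]

theorem update_image_insert {x y : M} {F : Set M} (hx : x ∉ F) :
    Function.update id x y '' insert x F = insert y F := by
  rw [Set.image_insert_eq, Function.update_self]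
  congr 1
  refine (Set.image_congr fun z hz => ?_).trans (Set.image_id F)
  rw [Function.update_of_ne (by rintro rfl; exact hx hz)]

/-- In a finite ordered structure, `breaks` is the set of all elements which cannot be exchanged
with their successor. -/
def breaks (L : FirstOrder.Language.{u, v}) (M : Type w) [L.Structure M] [LinearOrder M] : Set M :=
  {x | ∃ y, x ⋖ y ∧ ¬ Interchangeable L x y}

/-- Two exchanges give `F ∪ {x₁, y₂} ≅ F ∪ {x₂, y₂} ≅ F ∪ {x₂, y₁}`. Since `F` has no point between
`x₁` and `y₂`, the composite must fix `F` and send `x₁` to `y₁` and `y₂` to `x₂`; it is then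
restricted to `F ∪ {x₁}`. -/
theorem SameType.of_alternating {r : L.Relations 2} (hr : InterpretsLE M r) {F : Set M}
    (hF : F.Finite) {x₁ y₁ x₂ y₂ : M} (h₁ : x₁ < y₁) (h₂ : y₁ < x₂) (h₃ : x₂ < y₂)
    (hx₁ : x₁ ∉ F) (hx₂ : x₂ ∉ F) (hy₁ : y₁ ∉ F) (hy₂ : y₂ ∉ F)
    (hgap : ∀ w ∈ F, w < x₁ ∨ y₂ < w) (hx : Interchangeable L x₁ x₂)
    (hy : Interchangeable L y₁ y₂) : SameType L (insert x₁ F) (insert y₁ F) := by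
  have h₁₂ := h₁.trans h₂
  have h₁₃ := h₁₂.trans h₃
  have e₁ := hx (insert y₂ F) (hF.insert _) (by simp [h₁₃.ne, hx₁]) (by simp [h₃.ne, hx₂])
  have e₂ := hy.symm (insert x₂ F) (hF.insert _) (by simp [h₃.ne', hy₂]) (by simp [h₂.ne, hy₁])
  rw [Set.insert_comm] at e₂
  have e := e₁.trans e₂
  let θ : M → M := fun z => if z = x₁ then y₁ else if z = y₂ then x₂ else z
  have θ₁ : θ x₁ = y₁ := if_pos rfl
  have θ₂ : θ y₂ = x₂ := by simp [θ, h₁₃.ne']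
  have θF : ∀ z ∈ F, θ z = z := fun z hz => by
    have a₁ : z ≠ x₁ := by rintro rfl; exact hx₁ hz
    have a₂ : z ≠ y₂ := by rintro rfl; exact hy₂ hz
    simp [θ, a₁, a₂]
  have him : ∀ G ⊆ F, θ '' G = G := fun G hG =>
    (Set.image_congr fun z hz => θF z (hG hz)).trans (Set.image_id G)
  have hmono : StrictMonoOn θ (insert x₁ (insert y₂ F)) := by
    rintro a (rfl | rfl | ha) b (rfl | rfl | hb) hab
    · exact absurd hab (lt_irrefl _)
    · rwa [θ₁, θ₂]
    · rw [θ₁, θF b hb]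
      rcases hgap b hb with h | h
      · exact absurd (hab.trans h) (lt_irrefl _)
      · exact (h₂.trans h₃).trans h
    · exact absurd (h₁₃.trans hab) (lt_irrefl _)
    · exact absurd hab (lt_irrefl _)
    · rw [θ₂, θF b hb]; exact h₃.trans hab
    · rw [θ₁, θF a ha]; exact hab.trans h₁
    · rw [θ₂, θF a ha]
      rcases hgap a ha with h | h
      · exact h.trans h₁₂
      · exact absurd (hab.trans h) (lt_irrefl _)
    · rwa [θF a ha, θF b hb]
  have hiso := e.isoOn hr ((hF.insert _).insert _) hmono (by
    rw [Set.image_insert_eq, Set.image_insert_eq, θ₁, θ₂, him F subset_rfl])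
  have hsub : insert x₁ F ⊆ insert x₁ (insert y₂ F) :=
    Set.insert_subset_insert (Set.subset_insert _ _)
  refine ⟨θ, ?_, fun k R t ht => hiso.2 k R t fun i => hsub (ht i)⟩
  have := (hmono.mono hsub).injOn.bijOn_image
  rwa [Set.image_insert_eq, θ₁, him F subset_rfl] at this

/-- With more breaks than this, `3 * m + 2` of them share the colour of the point and that of its
successor. Two of these are then free of interference from the witness of a third, and the
alternation lemma shows that the third is no break. -/
theorem ncard_breaks_le [Finite M] {r : L.Relations 2} (hr : InterpretsLE M r) {m N : ℕ}
    (hm : ∀ (k : ℕ) (_ : L.Relations k), k ≤ m) {c : M → Fin N}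
    (hc : ∀ x y, c x = c y → Interchangeable L x y) :
    (breaks L M).ncard ≤ N * N * (3 * m + 1) := by
  classical
  have := Fintype.ofFinite M
  by_contra! hcon
  have hs : ∀ x : M, ∃ y, x ∈ breaks L M → x ⋖ y ∧ ¬ Interchangeable L x y := fun x => by
    by_cases hx : x ∈ breaks L M
    · exact hx.imp fun y hy _ => hy
    · exact ⟨x, fun h => absurd h hx⟩
  choose s hs using hs
  have hcard : (Finset.univ : Finset (Fin N × Fin N)).card * (3 * m + 1)
      < (breaks L M).toFinset.card := by
    rw [← Set.ncard_eq_toFinset_card']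
    simpa using hcon
  obtain ⟨⟨i, j⟩, -, hS⟩ := Finset.exists_lt_card_fiber_of_mul_lt_card_of_maps_to
    (f := fun x => (c x, c (s x))) (fun x _ => Finset.mem_univ _) hcard
  set S := {x ∈ (breaks L M).toFinset | (c x, c (s x)) = (i, j)} with hSdef
  have hS1 : ∀ x ∈ S, x ⋖ s x := fun x hx => (hs x (by simpa using (Finset.mem_filter.1 hx).1)).1
  have hS2 : ∀ x ∈ S, ¬ Interchangeable L x (s x) := fun x hx =>
    (hs x (by simpa using (Finset.mem_filter.1 hx).1)).2
  have hS3 : ∀ x ∈ S, c x = i ∧ c (s x) = j := fun x hx => by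
    simpa using (Finset.mem_filter.1 hx).2
  obtain ⟨x₀, hx₀⟩ : S.Nonempty := Finset.card_pos.1 (by omega)
  have hbreak := hS2 x₀ hx₀
  obtain ⟨k, R, t, ht, hR⟩ : ∃ (k : ℕ) (R : L.Relations k) (t : Fin k → M), (∀ i, t i ≠ s x₀) ∧
      ¬ (RelMap R (Function.update id x₀ (s x₀) ∘ t) ↔ RelMap R t) := by
    by_contra! h
    exact hbreak (Interchangeable.of_relMap fun k R t ht => h k R t ht)
  let F : Finset M := (Finset.univ.image t).erase x₀
  have hFcard : F.card ≤ m := (Finset.card_erase_le.trans Finset.card_image_le).trans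
    (by simpa using hm k R)
  have hx₀F : x₀ ∉ F := Finset.notMem_erase _ _
  have hy₀F : s x₀ ∉ F := fun h => by
    obtain ⟨l, -, hl⟩ := Finset.mem_image.1 (Finset.mem_of_mem_erase h)
    exact ht l hl
  have hinj : Set.InjOn s S := fun x hx y hy h => (hS1 x hx).unique_left (h ▸ hS1 y hy)
  have hc1 : {x ∈ S | x ∈ F}.card ≤ m :=
    (Finset.card_le_card fun x hx => (Finset.mem_filter.1 hx).2).trans hFcard
  have hc2 : {x ∈ S | s x ∈ F}.card ≤ m := by
    refine (Finset.card_le_card_of_injOn s (fun x hx => ?_) (hinj.mono ?_)).trans hFcard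
    · exact (Finset.mem_filter.1 hx).2
    · exact fun x hx => (Finset.mem_filter.1 hx).1
  -- Discarding breaks that meet `F`, or whose successor does, costs at most `2 * m` and leaves at
  -- least `m + 2`.
  let S' := S \ ({x ∈ S | x ∈ F} ∪ {x ∈ S | s x ∈ F})
  have hS'card : m + 1 < S'.card := by
    have := Finset.le_card_sdiff ({x ∈ S | x ∈ F} ∪ {x ∈ S | s x ∈ F}) S
    have := Finset.card_union_le {x ∈ S | x ∈ F} {x ∈ S | s x ∈ F}
    change m + 1 < (S \ _).card
    omega
  have hS' : ∀ x ∈ S', x ∈ S ∧ x ∉ F ∧ s x ∉ F := fun x hx => by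
    simp only [S', Finset.mem_sdiff, Finset.mem_union, Finset.mem_filter] at hx
    tauto
  -- The number of points of `F` below a break takes at most `m + 1` values; a coincidence means
  -- that `F` has no point between the two breaks.
  obtain ⟨x₁, hx₁, x₂, hx₂, hne, heq⟩ := Finset.exists_ne_map_eq_of_card_lt_of_maps_to
    (s := S') (t := Finset.range (m + 1)) (by simpa using hS'card)
    (f := fun x => {w ∈ F | w < x}.card)
    (fun x _ => by
      simp only [Finset.coe_range, Set.mem_Iio]
      exact Nat.lt_succ_of_le ((Finset.card_filter_le _ _).trans hFcard))
  wlog hlt : x₁ < x₂ generalizing x₁ x₂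
  · exact this x₂ hx₂ x₁ hx₁ hne.symm heq.symm (lt_of_le_of_ne (not_lt.1 hlt) hne.symm)
  obtain ⟨hx₁S, hx₁F, hy₁F⟩ := hS' x₁ hx₁
  obtain ⟨hx₂S, hx₂F, hy₂F⟩ := hS' x₂ hx₂
  have hE : ∀ {a b l}, c a = l → c b = l → Interchangeable L a b := fun ha hb =>
    hc _ _ (ha.trans hb.symm)
  have hy₁x₂ : s x₁ < x₂ := by
    refine lt_of_le_of_ne ((hS1 x₁ hx₁S).ge_of_gt hlt) fun h => hS2 x₁ hx₁S ?_
    rw [h]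
    exact hE (hS3 x₁ hx₁S).1 (hS3 x₂ hx₂S).1
  have hgap : ∀ w ∈ (F : Set M), w < x₁ ∨ s x₂ < w := by
    intro w hw
    rw [Finset.mem_coe] at hw
    by_contra! h
    have hw1 : x₁ < w := lt_of_le_of_ne h.1 (by rintro rfl; exact hx₁F hw)
    have hw2 : w < s x₂ := lt_of_le_of_ne h.2 (by rintro rfl; exact hy₂F hw)
    have hw3 : w < x₂ := lt_of_le_of_ne ((hS1 x₂ hx₂S).le_of_lt hw2)
      (by rintro rfl; exact hx₂F hw)
    refine (Finset.card_lt_card (s := {w ∈ F | w < x₁}) (t := {w ∈ F | w < x₂})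
      ⟨fun z hz => ?_, fun hsub => ?_⟩).ne heq
    · simp only [Finset.mem_filter] at hz ⊢
      exact ⟨hz.1, hz.2.trans hlt⟩
    · exact lt_asymm hw1 (Finset.mem_filter.1 (hsub (Finset.mem_filter.2 ⟨hw, hw3⟩))).2
  have e := SameType.of_alternating hr F.finite_toSet (hS1 x₁ hx₁S).lt hy₁x₂ (hS1 x₂ hx₂S).lt
    (by simpa using hx₁F) (by simpa using hx₂F) (by simpa using hy₁F) (by simpa using hy₂F) hgap
    (hE (hS3 x₁ hx₁S).1 (hS3 x₂ hx₂S).1) (hE (hS3 x₁ hx₁S).2 (hS3 x₂ hx₂S).2)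
  -- The chain is `F + x₀ ≅ F + x₁ ≅ F + s x₁ ≅ F + s x₀`; by rigidity this isomorphism is the
  -- update map, which was chosen not to preserve `R` on `t`.
  have e' := ((hE (hS3 x₀ hx₀).1 (hS3 x₁ hx₁S).1 F F.finite_toSet (by simpa using hx₀F)
    (by simpa using hx₁F)).trans e).trans (hE (hS3 x₁ hx₁S).2 (hS3 x₀ hx₀).2 F F.finite_toSet
    (by simpa using hy₁F) (by simpa using hy₀F))
  have hne0 := (hS1 x₀ hx₀).ne'
  refine hR ((e'.isoOn hr (F.finite_toSet.insert _) (strictMonoOn_update_of_covBy (hS1 x₀ hx₀)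
    (by simpa [hne0] using hy₀F)) (update_image_insert (by simpa using hx₀F))).2 k R t fun l => ?_)
  by_cases hl : t l = x₀
  · exact Or.inl hl
  · exact Or.inr (by simp [F, hl])

end Breaks

/-- Greedy choice in the digraph with edges from `x` to the points of `f x`: by double counting some
vertex of `V` has in-degree at most `d`, and keeping it costs at most `2 * d + 1` vertices. -/
theorem exists_free_subset {α : Type*} [DecidableEq α] {f : α → Finset α} {d : ℕ}
    (hf : ∀ x, (f x).card ≤ d) (h : ℕ) {V : Finset α} (hV : h * (2 * d + 1) ≤ V.card) :
    ∃ X ⊆ V, X.card = h ∧ ∀ x ∈ X, ∀ y ∈ X, x ≠ y → y ∉ f x := by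
  induction h generalizing V with
  | zero => exact ⟨∅, Finset.empty_subset _, rfl, by simp⟩
  | succ h ih =>
    have hpos : 0 < V.card := by
      refine lt_of_lt_of_le ?_ hV
      positivity
    obtain ⟨v, hv, hvd⟩ : ∃ v ∈ V, {x ∈ V | v ∈ f x}.card ≤ d := by
      by_contra! hcon
      have h1 : V.card * (d + 1) ≤ ∑ v ∈ V, {x ∈ V | v ∈ f x}.card := by
        rw [← smul_eq_mul]
        exact Finset.card_nsmul_le_sum _ _ _ fun v hv => hcon v hv
      have h2 : ∑ x ∈ V, {v ∈ V | v ∈ f x}.card ≤ V.card * d := by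
        rw [← smul_eq_mul]
        refine Finset.sum_le_card_nsmul _ _ _ fun x _ => ?_
        exact (Finset.card_le_card fun v hv => (Finset.mem_filter.1 hv).2).trans (hf x)
      have h3 := Finset.sum_card_bipartiteAbove_eq_sum_card_bipartiteBelow
        (s := V) (t := V) (fun x v => v ∈ f x)
      simp only [Finset.bipartiteAbove, Finset.bipartiteBelow] at h3
      rw [h3] at h2
      nlinarith
    let W := insert v (f v ∪ {x ∈ V | v ∈ f x})
    have hW : W.card ≤ 2 * d + 1 := by
      refine (Finset.card_insert_le _ _).trans ?_
      have := Finset.card_union_le (f v) {x ∈ V | v ∈ f x}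
      have := hf v
      omega
    obtain ⟨X, hXV, hX, hfree⟩ := ih (V := V \ W) (by
      have := Finset.le_card_sdiff W V
      rw [add_mul, one_mul] at hV
      omega)
    have hXW : ∀ x ∈ X, x ∈ V ∧ x ∉ W := fun x hx => Finset.mem_sdiff.1 (hXV hx)
    have hvX : v ∉ X := fun hvX => (hXW v hvX).2 (Finset.mem_insert_self _ _)
    refine ⟨insert v X, ?_, ?_, ?_⟩
    · exact Finset.insert_subset hv (hXV.trans Finset.sdiff_subset)
    · rw [Finset.card_insert_of_notMem hvX, hX]
    · intro x hx y hy hxy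
      rcases Finset.mem_insert.1 hx with rfl | hx' <;>
        rcases Finset.mem_insert.1 hy with rfl | hy'
      · exact absurd rfl hxy
      · exact fun h => (hXW y hy').2 (by simp [W, h])
      · exact fun h => (hXW x hx').2 (by simp [W, h, (hXW x hx').1])
      · exact hfree x hx' y hy' hxy

/-! ### Exponential lower bound from many breaks -/

section Growth

theorem AtLeastExponential.of_two_pow_le {f : ℕ → ℕ} (q : ℕ) (hq : 0 < q)
    (h : ∀ n, 2 ^ (n / q) ≤ f n) : AtLeastExponential f := by
  -- The base is the `2 * q`-th root of two; the factor 2 absorbs the rounding in `n / q`, as `n ≤ 2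
  -- * q * (n / q)` once `n ≥ q`.
  have hc : ((2 : ℝ) ^ ((2 * q : ℕ) : ℝ)⁻¹) ^ (2 * q) = 2 :=
    Real.rpow_inv_natCast_pow (by norm_num) (by omega)
  have hc1 : 1 < (2 : ℝ) ^ ((2 * q : ℕ) : ℝ)⁻¹ :=
    Real.one_lt_rpow (by norm_num) (by positivity)
  refine ⟨_, hc1, Filter.eventually_atTop.2 ⟨q, fun n hn => ?_⟩⟩
  have h1 : n ≤ 2 * q * (n / q) := by
    have := Nat.div_add_mod n q
    have := Nat.mod_lt n hq
    have := Nat.div_pos hn hq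
    nlinarith
  calc _ ≤ ((2 : ℝ) ^ ((2 * q : ℕ) : ℝ)⁻¹) ^ (2 * q * (n / q)) := pow_le_pow_right₀ hc1.le h1
    _ = 2 ^ (n / q) := by rw [pow_mul, hc]
    _ ≤ f n := by exact_mod_cast h n

end Growth

section Exponential

variable {L : FirstOrder.Language.{u, v}} [L.IsRelational]

theorem induced_mem_of_hereditary {C : Set (Bundled.{w} L.Structure)} (hC : Hereditary C)
    {M : Type w} [L.Structure M] (hM : (⟨M, ‹_›⟩ : Bundled.{w} L.Structure) ∈ C) {A : Set M}
    (hA : A.Finite) : (⟨induced L A, inferInstance⟩ : Bundled.{w} L.Structure) ∈ C := by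
  have : Finite (induced L A) := hA
  exact hC _ hM ⟨FG.of_finite, ⟨(induced L A).subtype⟩⟩

/-- The bound `h * (m + 1) ≤ n` leaves room for `h` breaks together with all their witnesses. In
`hcard`, the first term provides the independent breaks and the rest ensures enough points for
padding to size `n`. -/
theorem two_pow_le_profile [Finite (Σ n, L.Relations n)] {C : Set (Bundled.{w} L.Structure)}
    (hC : Hereditary C) {M : Type w} [L.Structure M] [LinearOrder M] [Finite M]
    (hM : (⟨M, ‹_›⟩ : Bundled.{w} L.Structure) ∈ C) {r : L.Relations 2} (hr : InterpretsLE M r)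
    {m : ℕ} (hm : ∀ (k : ℕ) (_ : L.Relations k), k ≤ m) {n h : ℕ} (hn : h * (m + 1) ≤ n)
    (hcard : h * (2 * (2 * m + 1) + 1) + n + h ≤ (breaks L M).ncard) :
    2 ^ h ≤ profile L C n := by
  classical
  have := Fintype.ofFinite M
  have hs : ∀ x : M, ∃ (y : M) (S : Finset M), S.card ≤ m ∧ (x ∈ breaks L M → x ⋖ y ∧
      x ∉ S ∧ y ∉ S ∧ ∃ (k : ℕ) (R : L.Relations k) (t : Fin k → M), (∀ i, t i ∈ insert x S) ∧
      ¬ (RelMap R (Function.update id x y ∘ t) ↔ RelMap R t)) := fun x => by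
    by_cases hx : x ∈ breaks L M
    · obtain ⟨y, hxy, hE⟩ := hx
      obtain ⟨k, R, t, ht, hR⟩ : ∃ (k : ℕ) (R : L.Relations k) (t : Fin k → M),
          (∀ i, t i ≠ y) ∧ ¬ (RelMap R (Function.update id x y ∘ t) ↔ RelMap R t) := by
        by_contra! h
        exact hE (Interchangeable.of_relMap fun k R t ht => h k R t ht)
      refine ⟨y, (Finset.univ.image t).erase x, (Finset.card_erase_le.trans
        Finset.card_image_le).trans (by simpa using hm k R), fun _ => ⟨hxy, Finset.notMem_erase _ _,
        fun h => ?_, k, R, t, fun i => ?_, hR⟩⟩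
      · obtain ⟨l, -, hl⟩ := Finset.mem_image.1 (Finset.mem_of_mem_erase h)
        exact ht l hl
      · by_cases hi : t i = x <;> simp [hi]
    · exact ⟨x, ∅, by simp, fun h => absurd h hx⟩
  choose s S hSm hs using hs
  have hsucc : ∀ x ∈ breaks L M, x ⋖ s x := fun x hx => (hs x hx).1
  have hinj : Set.InjOn s (breaks L M) := fun x hx y hy h =>
    (hsucc x hx).unique_left (h ▸ hsucc y hy)
  -- A break `x` conflicts with the points of `S x` (at most `m`), the breaks whose successor is in
  -- `S x` (at most `m`), and `s x`: hence `d = 2 * m + 1`.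
  obtain ⟨X, hXB, hXh, hfree⟩ := exists_free_subset
    (f := fun x => S x ∪ {z ∈ (breaks L M).toFinset | s z ∈ S x} ∪ {s x}) (d := 2 * m + 1)
    (fun x => by
      refine (Finset.card_union_le _ _).trans ?_
      have h1 := Finset.card_union_le (S x) {z ∈ (breaks L M).toFinset | s z ∈ S x}
      have h2 : {z ∈ (breaks L M).toFinset | s z ∈ S x}.card ≤ (S x).card :=
        Finset.card_le_card_of_injOn s (fun z hz => (Finset.mem_filter.1 hz).2)
          (hinj.mono fun z hz => by simpa using (Finset.mem_filter.1 hz).1)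
      have := hSm x
      rw [Finset.card_singleton]
      omega) h (V := (breaks L M).toFinset) (by rw [← Set.ncard_eq_toFinset_card']; omega)
  replace hXB : ∀ x ∈ X, x ∈ breaks L M := fun x hx => by simpa using hXB hx
  have hSX : ∀ x ∈ X, ∀ y ∈ X, y ∉ S x ∧ s y ∉ S x ∧ s x ≠ y := by
    intro x hx y hy
    rcases eq_or_ne x y with rfl | hxy
    · exact ⟨(hs x (hXB x hx)).2.1, (hs x (hXB x hx)).2.2.1, (hsucc x (hXB x hx)).ne'⟩
    · have := hfree x hx y hy hxy
      simp only [Finset.mem_union, Finset.mem_filter, Set.mem_toFinset, Finset.mem_singleton,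
        not_or, not_and] at this
      exact ⟨this.1.1, this.1.2 (hXB y hy), fun h => this.2 h.symm⟩
  -- The padding contains every witness set but no chosen break and no successor of one, so it stays
  -- fixed under all the moves.
  obtain ⟨P, hP1, hP2, hPcard⟩ := Finset.exists_subsuperset_card_eq
    (s := X.biUnion S) (t := Finset.univ \ (X ∪ X.image s)) (n := n - h)
    (fun z hz => by
      obtain ⟨x, hx, hzx⟩ := Finset.mem_biUnion.1 hz
      simp only [Finset.mem_sdiff, Finset.mem_univ, Finset.mem_union, Finset.mem_image, true_and,
        not_or]
      refine ⟨fun hzX => (hSX x hx z hzX).1 hzx, ?_⟩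
      rintro ⟨y, hy, rfl⟩
      exact (hSX x hx y hy).2.1 hzx)
    (by
      have := Finset.card_biUnion_le_card_mul X S m fun x _ => hSm x
      rw [hXh] at this
      rw [mul_add, mul_one] at hn
      omega)
    (by
      have h1 := Finset.le_card_sdiff (X ∪ X.image s) (Finset.univ : Finset M)
      have h2 := Finset.card_union_le X (X.image s)
      have h3 := Finset.card_image_le (s := X) (f := s)
      have h4 : (breaks L M).ncard ≤ (Finset.univ : Finset M).card := by
        rw [Set.ncard_eq_toFinset_card']
        exact Finset.card_le_card (Finset.subset_univ _)
      omega)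
  have hPX : ∀ z ∈ P, z ∉ X ∧ ∀ x ∈ X, s x ≠ z := fun z hz => by
    have := hP2 hz
    simp only [Finset.mem_sdiff, Finset.mem_univ, Finset.mem_union, Finset.mem_image, true_and,
      not_or, not_exists, not_and] at this
    exact this
  let A : Finset M := X ∪ P
  have hsA : ∀ x ∈ X, s x ∉ A := fun x hx h => by
    rcases Finset.mem_union.1 h with h | h
    · exact (hSX x hx _ h).2.2 rfl
    · exact (hPX _ h).2 x hx rfl
  have hAcard : A.card = n := by
    have hd : Disjoint X P := Finset.disjoint_right.2 fun z hz => (hPX z hz).1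
    have : h ≤ n := by nlinarith
    rw [Finset.card_union_of_disjoint hd, hXh, hPcard]
    omega
  let σ : Finset M → M → M := fun U z => if z ∈ U then s z else z
  have hσ : ∀ U ⊆ X, StrictMonoOn (σ U) A := by
    intro U hU a ha b hb hab
    have hbσ : b ≤ σ U b := by
      by_cases hbU : b ∈ U
      · simp only [σ, hbU, if_true]; exact (hsucc b (hXB b (hU hbU))).le
      · simp [σ, hbU]
    refine lt_of_lt_of_le ?_ hbσ
    by_cases haU : a ∈ U
    · simp only [σ, haU, if_true]
      exact lt_of_le_of_ne ((hsucc a (hXB a (hU haU))).ge_of_gt hab)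
        fun h => hsA a (hU haU) (h ▸ hb)
    · simpa [σ, haU] using hab
  have key : ∀ U ⊆ X, ∀ V ⊆ X, SameType L (σ U '' A) (σ V '' A) → V ⊆ U := by
    rintro U hU V hV ⟨g, hg⟩ x hxV
    by_contra hxU
    have hx := hV hxV
    obtain ⟨k, R, t, ht, hR⟩ := (hs x (hXB x hx)).2.2.2
    have htA : ∀ i, t i ∈ (A : Set M) := fun i => by
      rcases Finset.mem_insert.1 (ht i) with h | h
      · exact Finset.mem_union_left _ (h ▸ hx)
      · exact Finset.mem_union_right _ (hP1 (Finset.mem_biUnion.2 ⟨x, hx, h⟩))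
    have htX : ∀ i, t i ≠ x → t i ∉ X := fun i hi hiX =>
      (hSX x hx (t i) hiX).1 (Finset.mem_of_mem_insert_of_ne (ht i) hi)
    have h1 : σ U ∘ t = t := funext fun i => by
      have : t i ∉ U := fun h => by
        by_cases hi : t i = x
        · exact hxU (hi ▸ h)
        · exact htX i hi (hU h)
      simp [σ, this]
    have h2 : σ V ∘ t = Function.update id x (s x) ∘ t := funext fun i => by
      by_cases hi : t i = x
      · simp [σ, hi, hxV]
      · have : t i ∉ V := fun h => htX i hi (hV h)
        simp [σ, hi, this]
    -- By rigidity `g ∘ σ U = σ V` on `A`. For `x` in `V` but not in `U`, this map would preserve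
    -- the very relation that moving `x` to `s x` alters.
    have heq := eqOn_of_strictMonoOn_of_image_eq A.finite_toSet
      ((hg.strictMonoOn hr).comp (hσ U hU) (Set.mapsTo_image _ _)) (hσ V hV)
      (by rw [Set.image_comp, hg.1.image_eq])
    have h3 := hg.2 k R (σ U ∘ t) fun i => Set.mem_image_of_mem _ (htA i)
    rw [show g ∘ σ U ∘ t = σ V ∘ t from funext fun i => heq (htA i), h1, h2] at h3
    exact hR h3
  let Φ : Finset M → Quotient (equivSetoid (L := L)) := fun U =>
    Quotient.mk _ (⟨induced L (σ U '' A), inferInstance⟩ : Bundled.{w} L.Structure)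
  have hle := Set.ncard_le_ncard_of_injOn (s := (X.powerset : Set (Finset M)))
    (t := Quotient.mk (equivSetoid (L := L)) '' {M ∈ C | Finite M ∧ Nat.card M = n}) Φ
    (fun U hU => by
      have hU' : U ⊆ X := by simpa using hU
      refine ⟨_, ⟨induced_mem_of_hereditary hC hM (A.finite_toSet.image (σ U)),
        (A.finite_toSet.image (σ U)), ?_⟩, rfl⟩
      change (σ U '' A).ncard = n
      rw [(hσ U hU').injOn.ncard_image, Set.ncard_coe_finset, hAcard])
    (fun U hU V hV hUV => by
      have hU' : U ⊆ X := by simpa using hU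
      have hV' : V ⊆ X := by simpa using hV
      have hst : SameType L (σ U '' (A : Set M)) (σ V '' (A : Set M)) :=
        sameType_iff.2 (Quotient.exact hUV)
      exact (key V hV' U hU' hst.symm).antisymm (key U hU' V hV' hst))
    (finite_isoClasses L C n)
  rwa [Set.ncard_coe_finset, Finset.card_powerset, hXh] at hle

end Exponential

/-! ### Counting vectors in order-convex sets -/

section Counting

/-- `f` coincides with a polynomial from some rank on. -/
def EventuallyPolynomial (f : ℕ → ℚ) : Prop :=
  ∃ p : Polynomial ℚ, ∀ᶠ n : ℕ in Filter.atTop, f n = p.eval (n : ℚ)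

namespace EventuallyPolynomial

theorem congr {f g : ℕ → ℚ} (hf : EventuallyPolynomial f)
    (h : ∀ᶠ n : ℕ in Filter.atTop, g n = f n) : EventuallyPolynomial g := by
  obtain ⟨p, hp⟩ := hf
  exact ⟨p, by filter_upwards [hp, h] with n h1 h2 using h2.trans h1⟩

theorem zero : EventuallyPolynomial fun _ => 0 := ⟨0, by simp⟩

theorem add {f g : ℕ → ℚ} (hf : EventuallyPolynomial f) (hg : EventuallyPolynomial g) :
    EventuallyPolynomial fun n => f n + g n := by
  obtain ⟨p, hp⟩ := hf
  obtain ⟨q, hq⟩ := hg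
  exact ⟨p + q, by filter_upwards [hp, hq] with n h1 h2; rw [h1, h2, Polynomial.eval_add]⟩

theorem sub {f g : ℕ → ℚ} (hf : EventuallyPolynomial f) (hg : EventuallyPolynomial g) :
    EventuallyPolynomial fun n => f n - g n := by
  obtain ⟨p, hp⟩ := hf
  obtain ⟨q, hq⟩ := hg
  exact ⟨p - q, by filter_upwards [hp, hq] with n h1 h2; rw [h1, h2, Polynomial.eval_sub]⟩

theorem sum {ι : Type*} (s : Finset ι) {f : ι → ℕ → ℚ} (hf : ∀ i ∈ s, EventuallyPolynomial (f i)) :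
    EventuallyPolynomial fun n => ∑ i ∈ s, f i n := by
  classical
  induction s using Finset.induction_on with
  | empty => simpa using zero
  | insert a s ha ih =>
    simp only [Finset.sum_insert ha]
    exact (hf a (Finset.mem_insert_self _ _)).add
      (ih fun i hi => hf i (Finset.mem_insert_of_mem hi))

theorem comp_sub {f : ℕ → ℚ} (hf : EventuallyPolynomial f) (j : ℕ) :
    EventuallyPolynomial fun n => f (n - j) := by
  obtain ⟨p, hp⟩ := hf
  refine ⟨p.comp (Polynomial.X - Polynomial.C (j : ℚ)), ?_⟩
  filter_upwards [(Filter.tendsto_sub_atTop_nat j).eventually hp, Filter.eventually_ge_atTop j]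
    with n h1 h2
  rw [h1, Nat.cast_sub h2]
  simp

end EventuallyPolynomial

/-- Linearity reduces this to Faulhaber's formula. -/
theorem exists_polynomial_sum_range (p : Polynomial ℚ) :
    ∃ q : Polynomial ℚ, ∀ n : ℕ, ∑ i ∈ Finset.range n, p.eval (i : ℚ) = q.eval (n : ℚ) := by
  induction p using Polynomial.induction_on' with
  | add p q hp hq =>
    obtain ⟨p', hp⟩ := hp
    obtain ⟨q', hq⟩ := hq
    exact ⟨p' + q', fun n => by simp [Finset.sum_add_distrib, hp, hq]⟩
  | monomial k a =>
    refine ⟨Polynomial.C a * ∑ i ∈ Finset.range (k + 1), Polynomial.C (bernoulli i *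
      ((k + 1).choose i) / (k + 1)) * Polynomial.X ^ (k + 1 - i), fun n => ?_⟩
    simp only [Polynomial.eval_monomial, ← Finset.mul_sum, sum_range_pow, Polynomial.eval_mul,
      Polynomial.eval_C, Polynomial.eval_finsetSum, Polynomial.eval_pow, Polynomial.eval_X]
    congr 1
    exact Finset.sum_congr rfl fun i _ => by ring

theorem EventuallyPolynomial.sum_range {f : ℕ → ℚ} (hf : EventuallyPolynomial f) :
    EventuallyPolynomial fun n => ∑ i ∈ Finset.range n, f i := by
  obtain ⟨p, hp⟩ := hf
  obtain ⟨N, hN⟩ := Filter.eventually_atTop.1 hp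
  obtain ⟨q, hq⟩ := exists_polynomial_sum_range p
  refine ⟨q + Polynomial.C (∑ i ∈ Finset.range N, (f i - p.eval (i : ℚ))), ?_⟩
  filter_upwards [Filter.eventually_ge_atTop N] with n hn
  rw [Polynomial.eval_add, ← hq, Polynomial.eval_C]
  have : ∑ i ∈ Finset.range N, (f i - p.eval (i : ℚ))
      = ∑ i ∈ Finset.range n, (f i - p.eval (i : ℚ)) := by
    refine Finset.sum_subset (Finset.range_mono hn) fun i _ hi => ?_
    rw [hN i (by simpa using hi), sub_self]
  rw [this, ← Finset.sum_add_distrib]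
  simp

/-- Otherwise choose indices `j₀ ≤ j₁ ≤ …` and points `x n` of `D (j n)` outside `D (j (n + 1))`. A
pair `x a ≤ x b` with `a < b` puts `x a` in `D (j b) ⊆ D (j (a + 1))`, a contradiction. -/
theorem IsLowerSet.stabilizes {α : Type*} [Preorder α] [WellQuasiOrderedLE α] {D : ℕ → Set α}
    (hD : ∀ j, IsLowerSet (D j)) (hanti : Antitone D) : ∃ J, ∀ j, J ≤ j → D j = D J := by
  by_contra! hcon
  have : ∀ J, ∃ j x, J ≤ j ∧ x ∈ D J ∧ x ∉ D j := fun J => by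
    obtain ⟨j, hj, hne⟩ := hcon J
    obtain ⟨x, hx, hx'⟩ := Set.exists_of_ssubset ((hanti hj).ssubset_of_ne hne)
    exact ⟨j, x, hj, hx, hx'⟩
  choose next x hle hx hx' using this
  obtain ⟨a, b, hab, hxx⟩ := wellQuasiOrdered_le fun n => x (next^[n] 0)
  have hmono : Monotone fun n => next^[n] 0 := monotone_nat_of_le_succ fun n => by
    rw [Function.iterate_succ_apply']; exact hle _
  refine hx' (next^[a] 0) ?_
  have h1 : next^[a + 1] 0 ≤ next^[b] 0 := hmono hab
  rw [Function.iterate_succ_apply'] at h1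
  exact hD _ hxx (hanti h1 (hx _))

open Classical in
/-- The number of vectors in `D` with sum of entries `n`. -/
noncomputable def sumCount {K : ℕ} (D : Set (Fin K → ℕ)) (n : ℕ) : ℕ :=
  {x ∈ Finset.Nat.antidiagonalTuple K n | x ∈ D}.card

theorem sumCount_eq_ncard {K : ℕ} (D : Set (Fin K → ℕ)) (n : ℕ) :
    sumCount D n = {x | x ∈ D ∧ ∑ i, x i = n}.ncard := by
  rw [sumCount, ← Set.ncard_coe_finset]
  congr 1
  ext x
  simp [Finset.Nat.mem_antidiagonalTuple, and_comm]

theorem sumCount_succ {K : ℕ} (D : Set (Fin (K + 1) → ℕ)) (n : ℕ) :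
    sumCount D n = ∑ j ∈ Finset.range (n + 1),
      sumCount {y : Fin K → ℕ | (Fin.cons j y : Fin (K + 1) → ℕ) ∈ D} (n - j) := by
  classical
  rw [sumCount, Finset.card_eq_sum_card_fiberwise (f := fun x => x 0)
    (t := Finset.range (n + 1)) (fun x hx => by
      have := Finset.Nat.mem_antidiagonalTuple.1 (Finset.mem_filter.1 hx).1
      rw [Fin.sum_univ_succ] at this
      simp only [Finset.coe_range, Set.mem_Iio]
      omega)]
  refine Finset.sum_congr rfl fun j hj => ?_
  rw [Finset.mem_range] at hj
  refine Finset.card_bij' (fun x _ => Fin.tail x) (fun y _ => Fin.cons j y) ?_ ?_ ?_ ?_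
  · intro x hx
    simp only [Finset.mem_filter, Finset.Nat.mem_antidiagonalTuple, Fin.sum_univ_succ,
      Set.mem_ofPred_eq] at hx ⊢
    obtain ⟨⟨h1, h2⟩, rfl⟩ := hx
    refine ⟨?_, by rwa [Fin.cons_self_tail]⟩
    simp only [Fin.tail]
    omega
  · intro y hy
    simp only [Finset.mem_filter, Finset.Nat.mem_antidiagonalTuple, Fin.sum_univ_succ,
      Set.mem_ofPred_eq, Fin.cons_zero, Fin.cons_succ] at hy ⊢
    exact ⟨⟨by omega, hy.2⟩, trivial⟩
  · intro x hx
    obtain rfl := (Finset.mem_filter.1 hx).2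
    exact Fin.cons_self_tail x
  · intro y _
    exact Fin.tail_cons _ _

/-- Slicing by the first coordinate gives a decreasing sequence of lower sets, constant from some
`J` on. The slices below `J` contribute finitely many shifted counts, the others a partial sum of
one count. -/
theorem eventuallyPolynomial_sumCount_of_isLowerSet {K : ℕ} {D : Set (Fin K → ℕ)}
    (hD : IsLowerSet D) : EventuallyPolynomial fun n => (sumCount D n : ℚ) := by
  induction K with
  | zero =>
    refine EventuallyPolynomial.zero.congr ?_
    filter_upwards [Filter.eventually_ge_atTop 1] with n hn
    obtain ⟨n, rfl⟩ := Nat.exists_eq_add_of_le' hn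
    simp [sumCount]
  | succ K ih =>
    let S : ℕ → Set (Fin K → ℕ) := fun j => {y | (Fin.cons j y : Fin (K + 1) → ℕ) ∈ D}
    have hS : ∀ j, IsLowerSet (S j) := fun j y z hzy hy =>
      hD (Fin.cons_le_cons.2 ⟨le_rfl, hzy⟩) hy
    have hanti : Antitone S := fun i j hij y hy => hD (Fin.cons_le_cons.2 ⟨hij, le_rfl⟩) hy
    obtain ⟨J, hJ⟩ := IsLowerSet.stabilizes hS hanti
    have h1 := EventuallyPolynomial.sum (Finset.range J) fun j _ => (ih (hS j)).comp_sub j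
    -- The first coordinate from `J` to `n` leaves a remainder from `0` to `n - J` inclusive;
    -- `sum_range` omits the last value, hence the added term.
    have h2 := (((ih (hS J)).sum_range).comp_sub J).add ((ih (hS J)).comp_sub J)
    refine (h1.add h2).congr ?_
    filter_upwards [Filter.eventually_ge_atTop J] with n hn
    obtain ⟨d, rfl⟩ := Nat.exists_eq_add_of_le hn
    rw [sumCount_succ, add_assoc, Finset.sum_range_add, Nat.cast_add, Nat.cast_sum, Nat.cast_sum,
      Nat.add_sub_cancel_left, ← Finset.sum_range_succ (fun i => (sumCount (S J) i : ℚ)),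
      ← Finset.sum_range_reflect _ (d + 1)]
    congr 1
    refine Finset.sum_congr rfl fun i hi => ?_
    rw [Finset.mem_range] at hi
    rw [← hJ (J + (d + 1 - 1 - i)) (Nat.le_add_right _ _)]
    congr 2
    omega

theorem eventuallyPolynomial_sumCount {K : ℕ} {X : Set (Fin K → ℕ)} (hX : X.OrdConnected) :
    EventuallyPolynomial fun n => (sumCount X n : ℚ) := by
  classical
  let D : Set (Fin K → ℕ) := lowerClosure X
  have hD : IsLowerSet D := (lowerClosure X).lower
  have hXD : X ⊆ D := subset_lowerClosure
  have hD' : IsLowerSet (D \ X) := by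
    rintro x y hyx ⟨⟨z, hz, hxz⟩, hx⟩
    exact ⟨⟨z, hz, hyx.trans hxz⟩, fun hy => hx (hX.out hy hz ⟨hyx, hxz⟩)⟩
  refine ((eventuallyPolynomial_sumCount_of_isLowerSet hD).sub
    (eventuallyPolynomial_sumCount_of_isLowerSet hD')).congr (Filter.Eventually.of_forall
      fun n => ?_)
  rw [eq_sub_iff_add_eq, ← Nat.cast_add]
  congr 1
  have hfin : ∀ Y : Set (Fin K → ℕ), {x | x ∈ Y ∧ ∑ i, x i = n}.Finite := fun Y =>
    (Finset.Nat.antidiagonalTuple K n).finite_toSet.subset fun x hx =>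
      Finset.Nat.mem_antidiagonalTuple.2 hx.2
  rw [sumCount_eq_ncard, sumCount_eq_ncard, sumCount_eq_ncard,
    ← Set.ncard_union_eq (Set.disjoint_left.2 fun x h1 h2 => h2.1.2 h1.1) (hfin _) (hfin _)]
  congr 1
  ext x
  constructor
  · rintro (h | h)
    exacts [⟨hXD h.1, h.2⟩, ⟨h.1.1, h.2⟩]
  · rintro ⟨h1, h2⟩
    by_cases hx : x ∈ X
    exacts [Or.inl ⟨hx, h2⟩, Or.inr ⟨⟨h1, hx⟩, h2⟩]

theorem EventuallyPolynomial.eventuallyQuasiPolynomial {f : ℕ → ℕ}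
    (hf : EventuallyPolynomial fun n => (f n : ℚ)) : EventuallyQuasiPolynomial f := by
  obtain ⟨p, hp⟩ := hf
  refine ⟨p.natDegree, fun i _ => p.coeff i, fun i => ⟨1, one_pos, fun _ => rfl⟩, ?_⟩
  filter_upwards [hp] with n hn
  rw [hn, Polynomial.eval_eq_sum_range]

theorem EventuallyPolynomial.polynomiallyBounded {f : ℕ → ℕ}
    (hf : EventuallyPolynomial fun n => (f n : ℚ)) : PolynomiallyBounded f := by
  obtain ⟨p, hp⟩ := hf
  obtain ⟨N, hN⟩ := Filter.eventually_atTop.1 hp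
  -- Absolute values keep the polynomial part nonnegative, and the constant dominates the finitely
  -- many values before `p` takes over.
  refine ⟨(∑ i ∈ Finset.range (p.natDegree + 1), Polynomial.C (|(p.coeff i : ℝ)|) *
    Polynomial.X ^ i) + Polynomial.C (∑ i ∈ Finset.range N, (f i : ℝ)), fun n => ?_⟩
  simp only [Polynomial.eval_add, Polynomial.eval_finsetSum, Polynomial.eval_mul,
    Polynomial.eval_C, Polynomial.eval_pow, Polynomial.eval_X]
  rcases lt_or_ge n N with h | h
  · have h1 : (f n : ℝ) ≤ ∑ i ∈ Finset.range N, (f i : ℝ) :=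
      Finset.single_le_sum (f := fun i => (f i : ℝ)) (fun i _ => by positivity)
        (Finset.mem_range.2 h)
    have h2 : (0 : ℝ) ≤ ∑ i ∈ Finset.range (p.natDegree + 1), |(p.coeff i : ℝ)| * (n : ℝ) ^ i := by
      positivity
    linarith
  · have h1 := hN n h
    rw [Polynomial.eval_eq_sum_range] at h1
    have h2 : (f n : ℝ) = ∑ i ∈ Finset.range (p.natDegree + 1), (p.coeff i : ℝ) * (n : ℝ) ^ i := by
      exact_mod_cast h1
    have h3 : (0 : ℝ) ≤ ∑ i ∈ Finset.range N, (f i : ℝ) := by positivity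
    rw [h2]
    refine le_add_of_le_of_nonneg (Finset.sum_le_sum fun i _ => ?_) h3
    gcongr
    exact le_abs_self _

end Counting

/-! ### Canonical colouring and patterns -/

section Coloring

variable {L : FirstOrder.Language.{u, v}} {M : Type w} [L.Structure M] [LinearOrder M]

/-- The colouring of a finite ordered structure by consecutive numbers whose classes are the maximal
intervals which are monomorphic blocks. -/
structure IsCanonicalColoring (L : FirstOrder.Language.{u, v}) {M : Type w} [L.Structure M]
    [LinearOrder M] {K : ℕ} (c : M → Fin K) : Prop where
  mono : Monotone c
  same : ∀ x y, c x = c y → Interchangeable L x y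
  consecutive : ∀ x y, (c y : ℕ) = c x + 1 → ¬ Interchangeable L x y
  range : ∀ y, ∀ i ≤ c y, ∃ x, c x = i

theorem ncard_breaks_lt_of_covBy_of_mem [Finite M] {x y : M} (h : x ⋖ y) (hx : x ∈ breaks L M) :
    {z ∈ breaks L M | z < y}.ncard = {z ∈ breaks L M | z < x}.ncard + 1 := by
  rw [← Set.ncard_insert_of_notMem (a := x) (fun h => lt_irrefl x h.2) (Set.toFinite _)]
  congr 1
  ext z
  simp only [Set.mem_ofPred_eq, Set.mem_insert_iff]
  constructor
  · rintro ⟨h1, h2⟩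
    rcases (h.le_of_lt h2).eq_or_lt with h3 | h3
    exacts [Or.inl h3, Or.inr ⟨h1, h3⟩]
  · rintro (rfl | ⟨h1, h2⟩)
    exacts [⟨hx, h.lt⟩, ⟨h1, h2.trans h.lt⟩]

theorem ncard_breaks_lt_of_covBy_of_notMem {x y : M} (h : x ⋖ y) (hx : x ∉ breaks L M) :
    {z ∈ breaks L M | z < y}.ncard = {z ∈ breaks L M | z < x}.ncard := by
  congr 1
  ext z
  simp only [Set.mem_ofPred_eq]
  constructor
  · rintro ⟨h1, h2⟩
    exact ⟨h1, lt_of_le_of_ne (h.le_of_lt h2) (by rintro rfl; exact hx h1)⟩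
  · rintro ⟨h1, h2⟩
    exact ⟨h1, h2.trans h.lt⟩

/-- The colour of a point is the number of breaks strictly below it. -/
theorem exists_isCanonicalColoring [Finite M] {K : ℕ} (hK : (breaks L M).ncard < K) :
    ∃ c : M → Fin K, IsCanonicalColoring L c := by
  have := Fintype.ofFinite M
  have : IsStronglyCoatomic M := inferInstance
  let b : M → ℕ := fun x => {z ∈ breaks L M | z < x}.ncard
  have hbK : ∀ x, b x < K := fun x =>
    (Set.ncard_le_ncard (fun z hz => hz.1) (Set.toFinite _)).trans_lt hK
  have hmono : Monotone b := fun x y hxy =>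
    Set.ncard_le_ncard (fun z hz => ⟨hz.1, hz.2.trans_le hxy⟩) (Set.toFinite _)
  have hsame_lt : ∀ y x, x < y → b x = b y → Interchangeable L x y := by
    intro y
    induction y using WellFoundedLT.induction with
    | _ y ih =>
      intro x hxy hb
      obtain ⟨z, hxz, hzy⟩ := exists_le_covBy_of_lt hxy
      have hz : z ∉ breaks L M := fun hz => by
        have h1 : b y = b z + 1 := ncard_breaks_lt_of_covBy_of_mem hzy hz
        have := hmono hxz
        omega
      have h1 : b y = b z := ncard_breaks_lt_of_covBy_of_notMem hzy hz
      have h2 : Interchangeable L z y := by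
        by_contra h
        exact hz ⟨y, hzy, h⟩
      rcases hxz.eq_or_lt with rfl | hxz
      · exact h2
      · exact (ih z hzy.lt x hxz (hb.trans h1)).trans h2
  have hsame : ∀ x y, b x = b y → Interchangeable L x y := fun x y h => by
    rcases lt_trichotomy x y with h' | rfl | h'
    exacts [hsame_lt y x h' h, Interchangeable.refl x, (hsame_lt x y h' h.symm).symm]
  refine ⟨fun x => ⟨b x, hbK x⟩, fun x y h => hmono h, fun x y h => hsame x y (by simpa using h),
    fun x y h hE => ?_, fun y i hi => ?_⟩
  · replace h : b y = b x + 1 := h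
    -- The only break `z` in `[x, y)` has the colour of `x` and its successor that of `y`, so
    -- interchanging `x` with `y` would make `z` interchangeable with its successor.
    obtain ⟨z, hz, hxz, hzy⟩ : ∃ z ∈ breaks L M, x ≤ z ∧ z < y := by
      by_contra! hcon
      have : b y ≤ b x := Set.ncard_le_ncard (fun z hz => ⟨hz.1, by
        by_contra h'
        exact absurd hz.2 (not_lt.2 (hcon z hz.1 (not_lt.1 h')))⟩) (Set.toFinite _)
      omega
    obtain ⟨z', hzz', hzE⟩ := hz
    have h1 : b z' = b z + 1 := ncard_breaks_lt_of_covBy_of_mem hzz' ⟨z', hzz', hzE⟩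
    have h2 := hmono hxz
    have h3 := hmono (hzz'.ge_of_gt hzy)
    exact hzE (((hsame z x (by omega)).trans hE).trans (hsame y z' (by omega)))
  · replace hi : (i : ℕ) ≤ b y := hi
    suffices ∃ x, b x = i from this.imp fun x hx => Fin.ext hx
    induction y using WellFoundedLT.induction with
    | _ y ih =>
      rcases hi.eq_or_lt with h | h
      · exact ⟨y, h.symm⟩
      · obtain ⟨x, -, hxy⟩ := (Set.ncard_pos (Set.toFinite _)).1 (Nat.zero_lt_of_lt h)
        obtain ⟨z, -, hzy⟩ := exists_le_covBy_of_lt hxy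
        refine ih z hzy.lt ?_
        by_cases hz : z ∈ breaks L M
        · have h1 : b y = b z + 1 := ncard_breaks_lt_of_covBy_of_mem hzy hz
          omega
        · have h1 : b y = b z := ncard_breaks_lt_of_covBy_of_notMem hzy hz
          omega

namespace IsCanonicalColoring

variable {K : ℕ} {c c' : M → Fin K}

theorem eq_zero (hc : IsCanonicalColoring L c) {y : M} (hy : IsMin y) : (c y : ℕ) = 0 := by
  obtain ⟨x, hx⟩ := hc.range y ⟨0, (Nat.zero_le _).trans_lt (c y).2⟩ (Nat.zero_le _)
  have h : c y ≤ c x := hc.mono ((le_total x y).elim (fun h => hy h) id)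
  rw [hx] at h
  exact Nat.le_zero.1 h

/-- This step rule determines the colouring by induction from the minimum, which gives `unique`. -/
theorem covBy (hc : IsCanonicalColoring L c) {x y : M} (h : x ⋖ y) :
    (Interchangeable L x y ∧ c y = c x) ∨ (¬ Interchangeable L x y ∧ (c y : ℕ) = c x + 1) := by
  have hxy : c x ≤ c y := hc.mono h.le
  rcases hxy.eq_or_lt with heq | hlt
  · exact Or.inl ⟨hc.same x y heq, heq.symm⟩
  · have hlt' : (c x : ℕ) + 1 ≤ c y := hlt
    obtain ⟨z, hz⟩ := hc.range y ⟨c x + 1, hlt'.trans_lt (c y).2⟩ hlt'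
    have hxz : x < z := by
      by_contra h'
      have : c z ≤ c x := hc.mono (not_lt.1 h')
      rw [hz] at this
      exact absurd this (Nat.not_succ_le_self _)
    have hyz : c y ≤ c z := hc.mono (h.ge_of_gt hxz)
    rw [hz] at hyz
    have h1 : (c y : ℕ) = c x + 1 := le_antisymm hyz hlt'
    exact Or.inr ⟨hc.consecutive x y h1, h1⟩

theorem unique [Finite M] (hc : IsCanonicalColoring L c) (hc' : IsCanonicalColoring L c') :
    c = c' := by
  have := Fintype.ofFinite M
  have : IsStronglyCoatomic M := inferInstance
  funext y
  induction y using WellFoundedLT.induction with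
  | _ y ih =>
    by_cases hy : IsMin y
    · exact Fin.ext ((hc.eq_zero hy).trans (hc'.eq_zero hy).symm)
    · obtain ⟨x, hxy⟩ := not_isMin_iff.1 hy
      obtain ⟨z, -, hzy⟩ := exists_le_covBy_of_lt hxy
      have hz := ih z hzy.lt
      rcases hc.covBy hzy with ⟨h1, h2⟩ | ⟨h1, h2⟩ <;>
        rcases hc'.covBy hzy with ⟨h3, h4⟩ | ⟨h3, h4⟩
      · rw [h2, h4, hz]
      · exact absurd h1 h3
      · exact absurd h3 h1
      · exact Fin.ext (by rw [h2, h4, hz])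

theorem comp_equiv [L.IsRelational] {N : Type w} [L.Structure N] [LinearOrder N] {c : N → Fin K}
    (hc : IsCanonicalColoring L c) (e : M ≃[L] N) (he : Monotone e) :
    IsCanonicalColoring L (c ∘ e) where
  mono := hc.mono.comp he
  same x y h := (Interchangeable.iff_of_equiv e).1 (hc.same _ _ h)
  consecutive x y h hE := hc.consecutive _ _ h ((Interchangeable.iff_of_equiv e).2 hE)
  range y i hi := by
    obtain ⟨x, hx⟩ := hc.range (e y) i hi
    exact ⟨e.symm x, by simpa using hx⟩

/-- Whether a tuple is in a relation depends only on the colours and the order of its entries. -/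
theorem relMap_iff {r : L.Relations 2} (hr : InterpretsLE M r) (hc : IsCanonicalColoring L c)
    {k : ℕ} (R : L.Relations k) {t t' : Fin k → M} (hcol : c ∘ t = c ∘ t')
    (hord : ∀ i j, t i ≤ t j ↔ t' i ≤ t' j) : RelMap R t ↔ RelMap R t' := by
  classical
  have hfac : Function.FactorsThrough t' t := fun i j hij =>
    le_antisymm ((hord i j).1 hij.le) ((hord j i).1 hij.ge)
  let θ : M → M := Function.extend t t' id
  have hθ : ∀ i, θ (t i) = t' i := fun i => hfac.extend_apply _ i
  have hmono : StrictMonoOn θ (Set.range t) := by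
    rintro _ ⟨i, rfl⟩ _ ⟨j, rfl⟩ hij
    rw [hθ, hθ]
    rw [← not_le] at hij ⊢
    rwa [← hord]
  have him : θ '' Set.range t = Set.range t' := by
    rw [← Set.range_comp]
    exact congrArg Set.range (funext hθ)
  have hcθ : ∀ z ∈ Set.range t, c (θ z) = c z := by
    rintro _ ⟨i, rfl⟩
    rw [hθ]
    exact (congrFun hcol i).symm
  have hst : SameType L (Set.range t) (Set.range t') := by
    refine SameType.of_ncard_fiber hc.same (Set.finite_range t) (Set.finite_range t') fun i => ?_
    rw [← (hmono.injOn.mono Set.inter_subset_left).ncard_image, ← him]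
    congr 1
    ext z
    constructor
    · rintro ⟨y, ⟨hy, hy'⟩, rfl⟩
      exact ⟨⟨y, hy, rfl⟩, (hcθ y hy).trans hy'⟩
    · rintro ⟨⟨y, hy, rfl⟩, hz⟩
      exact ⟨y, ⟨hy, (hcθ y hy).symm.trans hz⟩, rfl⟩
  have := (hst.isoOn hr (Set.finite_range t) hmono him).2 k R t fun i => Set.mem_range_self i
  rw [← this]
  exact iff_of_eq (congrArg _ (funext hθ))

end IsCanonicalColoring

/-- The possible data of tuples in a coloured ordered structure: a relation symbol, the colours of
the entries, their order, and whether the relation holds. -/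
abbrev TupleData (L : FirstOrder.Language.{u, v}) (K : ℕ) : Type v :=
  Σ p : (Σ k, L.Relations k), (Fin p.1 → Fin K) × (Fin p.1 → Fin p.1 → Prop) × Prop

/-- The data of all tuples of a coloured ordered structure. -/
def pattern (L : FirstOrder.Language.{u, v}) {M : Type w} [L.Structure M] [LinearOrder M] {K : ℕ}
    (c : M → Fin K) : Set (TupleData L K) :=
  {q | ∃ t : Fin q.1.1 → M, c ∘ t = q.2.1 ∧ (∀ i j, q.2.2.1 i j ↔ t i ≤ t j) ∧
    (q.2.2.2 ↔ RelMap q.1.2 t)}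

variable {N : Type w} [L.Structure N] [LinearOrder N] {K : ℕ} {c : M → Fin K} {c' : N → Fin K}
  {r : L.Relations 2}

theorem relMap_comp_iff_of_pattern_subset (hr : InterpretsLE N r) (hc' : IsCanonicalColoring L c')
    (hp : pattern L c ⊆ pattern L c') {e : M → N} (he : StrictMono e) (hce : c' ∘ e = c) {k : ℕ}
    (R : L.Relations k) (t : Fin k → M) : RelMap R (e ∘ t) ↔ RelMap R t := by
  obtain ⟨t', h1, h2, h3⟩ := hp (show (⟨⟨k, R⟩, c ∘ t, fun i j => t i ≤ t j, RelMap R t⟩ :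
    TupleData L K) ∈ pattern L c from ⟨t, rfl, fun _ _ => Iff.rfl, Iff.rfl⟩)
  refine (hc'.relMap_iff hr R ?_ fun i j => ?_).trans h3.symm
  · rw [← Function.comp_assoc, hce]; exact h1.symm
  · exact he.le_iff_le.trans (h2 i j)

theorem pattern_subset_of_relMap_comp {e : M → N} (he : StrictMono e) (hce : c' ∘ e = c)
    (hR : ∀ (k : ℕ) (R : L.Relations k) (t : Fin k → M), RelMap R (e ∘ t) ↔ RelMap R t) :
    pattern L c ⊆ pattern L c' := by
  rintro q ⟨t, h1, h2, h3⟩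
  refine ⟨e ∘ t, ?_, fun i j => (h2 i j).trans he.le_iff_le.symm, h3.trans (hR _ _ t).symm⟩
  rw [← Function.comp_assoc, hce, h1]

/-- The pair `(x, x)` for the order symbol records the colour of `x` in the pattern. -/
theorem exists_eq_of_pattern_subset (hr : InterpretsLE M r)
    (hp : pattern L c ⊆ pattern L c') (x : M) : ∃ y, c' y = c x := by
  obtain ⟨t, h, -⟩ := hp (show (⟨⟨2, r⟩, fun _ => c x, fun _ _ => True, True⟩ :
    TupleData L K) ∈ pattern L c from ⟨![x, x], funext fun i => by fin_cases i <;> rfl,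
      fun i j => by fin_cases i <;> fin_cases j <;> simp, by simpa using (hr x x).2 le_rfl⟩)
  exact ⟨t 0, congrFun h 0⟩

/-- Each fibre is a finite chain and embeds in the corresponding one; monotonicity of both
colourings makes the glued map increasing. -/
theorem exists_strictMono_of_ncard_fiber_le [Finite M] [Finite N] (hc : Monotone c)
    (hc' : Monotone c') (h : ∀ i, (c ⁻¹' {i}).ncard ≤ (c' ⁻¹' {i}).ncard) :
    ∃ e : M → N, StrictMono e ∧ c' ∘ e = c := by
  classical
  have := Fintype.ofFinite M
  have := Fintype.ofFinite N
  have hex : ∀ i, Nonempty ((c ⁻¹' {i} : Set M) ↪o (c' ⁻¹' {i} : Set N)) := fun i => by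
    have h' : Fintype.card (c ⁻¹' {i} : Set M) ≤ Fintype.card (c' ⁻¹' {i} : Set N) := by
      rw [Fintype.card_eq_nat_card, Fintype.card_eq_nat_card]
      exact h i
    exact ⟨((Fintype.orderIsoFinOfCardEq (c ⁻¹' {i} : Set M) rfl).symm.toOrderEmbedding.trans
      (Fin.castLEOrderEmb h')).trans
      (Fintype.orderIsoFinOfCardEq (c' ⁻¹' {i} : Set N) rfl).toOrderEmbedding⟩
  have φ := fun i => (hex i).some
  have hce : ∀ z, c' (φ (c z) ⟨z, rfl⟩ : N) = c z := fun z => (φ (c z) ⟨z, rfl⟩).2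
  refine ⟨fun z => (φ (c z) ⟨z, rfl⟩ : N), fun x y hxy => ?_, funext hce⟩
  rcases (hc hxy.le).eq_or_lt with heq | hlt
  · have : ∀ i (hi : c x = i), (φ (c x) ⟨x, rfl⟩ : N) = φ i ⟨x, hi⟩ := by rintro _ rfl; rfl
    change (φ (c x) ⟨x, rfl⟩ : N) < φ (c y) ⟨y, rfl⟩
    rw [this _ heq]
    exact (φ (c y)).strictMono hxy
  · refine lt_of_not_ge fun hle => ?_
    have := hc' hle
    rw [hce, hce] at this
    exact absurd this (not_le.2 hlt)

end Coloring

/-! ### Codes of finite ordered structures -/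

section Code

variable {L : FirstOrder.Language.{u, v}}

/-- `M` is ordered by `r` and its canonical colouring has pattern `f` and fibres of sizes `x`. -/
def HasCode (r : L.Relations 2) (M : Type w) [L.Structure M] {K : ℕ} (f : Set (TupleData L K))
    (x : Fin K → ℕ) : Prop :=
  ∃ (_ : LinearOrder M) (c : M → Fin K), InterpretsLE M r ∧ IsCanonicalColoring L c ∧
    pattern L c = f ∧ ∀ i, (c ⁻¹' {i}).ncard = x i

variable {r : L.Relations 2} {M N : Type w} [L.Structure M] [L.Structure N] {K : ℕ}
  {f f' : Set (TupleData L K)} {x y z : Fin K → ℕ}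

theorem InterpretsLE.strictMono [LinearOrder M] [LinearOrder N] (hM : InterpretsLE M r)
    (hN : InterpretsLE N r) (e : M ↪[L] N) : StrictMono e := by
  refine Monotone.strictMono_of_injective (fun a b hab => ?_) e.injective
  have := (e.map_rel r ![a, b]).2 ((hM a b).2 hab)
  rwa [show e ∘ ![a, b] = ![e a, e b] from funext fun i => by fin_cases i <;> rfl, hN] at this

theorem InterpretsLE.induced [L.IsRelational] [LinearOrder M] (hM : InterpretsLE M r) (A : Set M) :
    InterpretsLE (induced L A) r := fun a b => by
  rw [← Subtype.coe_le_coe, ← hM]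
  change RelMap r (Subtype.val ∘ ![a, b]) ↔ _
  rw [show Subtype.val ∘ ![a, b] = ![(a : M), (b : M)] from
    funext fun i => by fin_cases i <;> rfl]

theorem HasCode.card_eq [Finite M] (h : HasCode r M f x) : Nat.card M = ∑ i, x i := by
  classical
  have := Fintype.ofFinite M
  obtain ⟨_, c, -, -, -, hx⟩ := h
  rw [Nat.card_eq_fintype_card, ← Finset.card_univ,
    Finset.card_eq_sum_card_fiberwise (f := c) (t := Finset.univ) (fun _ _ => Finset.mem_univ _)]
  refine Finset.sum_congr rfl fun i _ => ?_
  rw [← hx i, ← Set.ncard_coe_finset]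
  congr 1
  ext z
  simp

/-- An isomorphism preserves the order, hence carries one canonical colouring to the other by
uniqueness. -/
theorem HasCode.unique [L.IsRelational] [Finite M] (h : HasCode r M f x) (e : M ≃[L] N)
    (h' : HasCode r N f' y) : f = f' ∧ x = y := by
  obtain ⟨_, c, hr, hc, rfl, hx⟩ := h
  obtain ⟨_, c', hr', hc', rfl, hy⟩ := h'
  have he : StrictMono e := hr.strictMono hr' e.toEmbedding
  have he' : StrictMono e.symm := hr'.strictMono hr e.symm.toEmbedding
  have hce : c' ∘ e = c := (hc'.comp_equiv e he.monotone).unique hc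
  have hce' : c ∘ e.symm = c' := by
    rw [← hce]
    exact funext fun z => by simp
  refine ⟨(pattern_subset_of_relMap_comp he hce fun k R t => e.map_rel R t).antisymm
    (pattern_subset_of_relMap_comp he' hce' fun k R t => e.symm.map_rel R t), funext fun i => ?_⟩
  rw [← hx, ← hy, ← hce, Set.preimage_comp,
    Set.ncard_preimage_of_injective_subset_range e.injective]
  rw [e.surjective.range_eq]
  exact Set.subset_univ _

theorem HasCode.exists_embedding [L.IsRelational] [Finite M] [Finite N] (h : HasCode r M f x)
    (h' : HasCode r N f y) (hxy : x ≤ y) : Nonempty (M ↪[L] N) := by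
  obtain ⟨_, c, hr, hc, rfl, hx⟩ := h
  obtain ⟨_, c', hr', hc', hf, hy⟩ := h'
  obtain ⟨e, he, hce⟩ := exists_strictMono_of_ncard_fiber_le hc.mono hc'.mono
    (fun i => by rw [hx, hy]; exact hxy i)
  exact ⟨{ toFun := e, inj' := he.injective, map_fun' := fun f => isEmptyElim f
           map_rel' := relMap_comp_iff_of_pattern_subset hr' hc' hf.ge he hce }⟩

theorem HasCode.nonempty_equiv [L.IsRelational] [Finite M] [Finite N] (h : HasCode r M f x)
    (h' : HasCode r N f x) : Nonempty (M ≃[L] N) := by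
  obtain ⟨e⟩ := h.exists_embedding h' le_rfl
  have hcard : Nat.card M = Nat.card N := h.card_eq.trans h'.card_eq.symm
  have hb : Function.Bijective e := e.injective.bijective_of_nat_card_le hcard.ge
  exact ⟨{ toEquiv := Equiv.ofBijective e hb, map_fun' := fun f => isEmptyElim f
           map_rel' := fun R t => e.map_rel R t }⟩

/-- The required set contains a copy of `M` and has `y i` points of colour `i` in `N`; its pattern
is squeezed between two equal ones. The lower bound `x` matters: without a copy of `M`, neighbouring
colour classes could become interchangeable and merge. -/
theorem HasCode.exists_induced [L.IsRelational] [Finite M] [Finite N] (hM : HasCode r M f x)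
    (hN : HasCode r N f z) (hxy : x ≤ y) (hyz : y ≤ z) :
    ∃ A : Set N, HasCode r (induced L A) f y := by
  obtain ⟨_, c, hr, hc, hf, hx⟩ := hM
  obtain ⟨_, c', hr', hc', hf', hz⟩ := hN
  have hfc : pattern L c = pattern L c' := hf.trans hf'.symm
  obtain ⟨e, he, hce⟩ := exists_strictMono_of_ncard_fiber_le hc.mono hc'.mono
    (fun i => by rw [hx, hz]; exact hxy.trans hyz i)
  have hR := fun k R t => relMap_comp_iff_of_pattern_subset (k := k) hr' hc' hfc.le he hce R t
  have hS : ∀ i, ∃ S : Set N, e '' (c ⁻¹' {i}) ⊆ S ∧ S ⊆ c' ⁻¹' {i} ∧ S.ncard = y i := fun i => by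
    refine Set.exists_subsuperset_card_eq ?_ ?_ ?_
    · rintro _ ⟨a, ha, rfl⟩
      exact (congrFun hce a).trans ha
    · rw [he.injective.injOn.ncard_image, hx]; exact hxy i
    · rw [hz]; exact hyz i
  choose S hS₁ hS₂ hS₃ using hS
  let A : Set N := ⋃ i, S i
  have heA : ∀ a, e a ∈ A := fun a => Set.mem_iUnion.2 ⟨c a, hS₁ _ ⟨a, rfl, rfl⟩⟩
  let d : induced L A → Fin K := fun a => c' a
  let ι : M ↪[L] induced L A :=
    { toFun := fun a => ⟨e a, heA a⟩
      inj' := fun a b h => he.injective (congrArg Subtype.val h)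
      map_fun' := fun f => isEmptyElim f
      map_rel' := fun {k} R t => hR k R t }
  have hι : ∀ a, d (ι a) = c a := fun a => congrFun hce a
  have hM : ∀ b : N, ∃ a, c a = c' b := exists_eq_of_pattern_subset hr' hfc.ge
  have hsame : ∀ a b, d a = d b → Interchangeable L a b := fun a b hab =>
    Interchangeable.of_embedding (induced L A).subtype (hc'.same _ _ hab)
  refine ⟨A, inferInstance, d, hr'.induced A, ⟨fun a b hab => hc'.mono hab, hsame,
    fun a b hab hE => ?_, fun b i hi => ?_⟩, ?_, fun i => ?_⟩
  · obtain ⟨a₀, ha₀⟩ := hM a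
    obtain ⟨b₀, hb₀⟩ := hM b
    -- Replacing `a` and `b` by points of the copy of `M` with the same colours moves the
    -- interchange into `M`, where consecutive colours forbid it.
    refine hc.consecutive a₀ b₀ (by rw [ha₀, hb₀]; exact hab) (Interchangeable.of_embedding ι ?_)
    exact ((hsame _ _ ((hι a₀).trans ha₀)).trans hE).trans (hsame _ _ ((hι b₀).trans hb₀).symm)
  · obtain ⟨b', hb'⟩ := hc'.range b i hi
    obtain ⟨a, ha⟩ := hM b'
    exact ⟨ι a, (hι a).trans (ha.trans hb')⟩
  · refine Set.Subset.antisymm ?_ ?_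
    · rw [← hf']
      exact pattern_subset_of_relMap_comp (e := Subtype.val) (fun a b hab => hab) rfl
        fun k R t => Iff.rfl
    · rw [← hf]
      exact pattern_subset_of_relMap_comp (e := ι) (fun a b hab => he hab) (funext hι)
        fun k R t => ι.map_rel R t
  · rw [← hS₃ i, ← Subtype.val_injective.injOn.ncard_image (s := d ⁻¹' {i})]
    congr 1
    ext b
    constructor
    · rintro ⟨b, hb, rfl⟩
      obtain ⟨j, hj⟩ := Set.mem_iUnion.1 b.2
      obtain rfl : j = i := (hS₂ j hj : c' b = j).symm.trans hb
      exact hj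
    · exact fun hb => ⟨⟨b, Set.mem_iUnion.2 ⟨i, hb⟩⟩, hS₂ i hb, rfl⟩

/-- Isomorphism types of size `n` correspond bijectively to realised codes of sum `n`, summed over
finitely many patterns. -/
theorem eventuallyPolynomial_profile_of_ncard_breaks_lt [L.IsRelational]
    [Finite (Σ n, L.Relations n)] {C : Set (Bundled.{w} L.Structure)} (hC : Hereditary C)
    (hfin : ∀ M ∈ C, Finite M) (r : L.Relations 2) (K : ℕ)
    (h : ∀ M ∈ C, ∃ _ : LinearOrder M, InterpretsLE M r ∧ (breaks L M).ncard < K) :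
    EventuallyPolynomial fun n => (profile L C n : ℚ) := by
  classical
  have := Fintype.ofFinite (Set (TupleData L K))
  let X : Set (TupleData L K) → Set (Fin K → ℕ) := fun f => {x | ∃ M ∈ C, HasCode r M f x}
  have hX : ∀ f, (X f).OrdConnected := by
    refine fun f => ⟨?_⟩
    rintro x ⟨M, hM, hMx⟩ z ⟨N, hN, hNz⟩ y ⟨hxy, hyz⟩
    have := hfin M hM
    have := hfin N hN
    obtain ⟨A, hA⟩ := hMx.exists_induced hNz hxy hyz
    exact ⟨_, induced_mem_of_hereditary hC hN A.toFinite, hA⟩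
  refine (EventuallyPolynomial.sum Finset.univ fun f _ =>
    eventuallyPolynomial_sumCount (hX f)).congr (Filter.Eventually.of_forall fun n => ?_)
  rw [← Nat.cast_sum]
  congr 1
  simp only [sumCount]
  let T : Finset (Σ _ : Set (TupleData L K), Fin K → ℕ) :=
    Finset.univ.sigma fun f => {x ∈ Finset.Nat.antidiagonalTuple K n | x ∈ X f}
  have hmem : ∀ p, p ∈ T ↔ (∃ M ∈ C, HasCode r M p.1 p.2) ∧ ∑ i, p.2 i = n := fun p => by
    simp only [T, Finset.mem_sigma, Finset.mem_univ, true_and, Finset.mem_filter,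
      Finset.Nat.mem_antidiagonalTuple]
    exact and_comm
  have hT := fun p hp => (hmem p).1 hp
  rw [← Finset.card_sigma]
  change _ = T.card
  rw [← Set.ncard_coe_finset, profile]
  symm
  refine Set.ncard_congr (fun p hp => Quotient.mk _ (hT p hp).1.choose) ?_ ?_ ?_
  · intro p hp
    obtain ⟨hM, hcode⟩ := (hT p hp).1.choose_spec
    have := hfin _ hM
    exact ⟨_, ⟨hM, this, hcode.card_eq.trans (hT p hp).2⟩, rfl⟩
  · rintro ⟨f, x⟩ ⟨g, y⟩ hp hq heq
    obtain ⟨hM, hcode⟩ := (hT _ hp).1.choose_spec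
    obtain ⟨-, hcode'⟩ := (hT _ hq).1.choose_spec
    have := hfin _ hM
    obtain ⟨e⟩ : Nonempty (_ ≃[L] _) := Quotient.exact heq
    obtain ⟨rfl, rfl⟩ := hcode.unique e hcode'
    rfl
  · rintro _ ⟨M, ⟨hM, hMfin, hMn⟩, rfl⟩
    obtain ⟨_, hr, hK⟩ := h M hM
    obtain ⟨c, hc⟩ := exists_isCanonicalColoring hK
    have hcode : HasCode r M (pattern L c) (fun i => (c ⁻¹' {i}).ncard) :=
      ⟨_, c, hr, hc, rfl, fun _ => rfl⟩
    have hp : ⟨pattern L c, fun i => (c ⁻¹' {i}).ncard⟩ ∈ T :=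
      (hmem _).2 ⟨⟨M, hM, hcode⟩, hcode.card_eq.symm.trans hMn⟩
    refine ⟨_, hp, Quotient.sound ?_⟩
    obtain ⟨hN, hcode'⟩ := (hT _ hp).1.choose_spec
    have := hfin _ hN
    exact hcode'.nonempty_equiv hcode

end Code

/-! ### Hereditary classes: the dichotomy -/

section Classes

variable {L : FirstOrder.Language.{u, v}}

/-- The symbol `r` is interpreted by a linear order. -/
def OrderedBy (r : L.Relations 2) (M : Type w) [L.Structure M] : Prop :=
  (∀ a : M, RelMap r ![a, a]) ∧
  (∀ a b c : M, RelMap r ![a, b] → RelMap r ![b, c] → RelMap r ![a, c]) ∧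
  (∀ a b : M, RelMap r ![a, b] → RelMap r ![b, a] → a = b) ∧
  (∀ a b : M, RelMap r ![a, b] ∨ RelMap r ![b, a])

theorem isOrdered_iff {M : Type w} [L.Structure M] :
    IsOrdered L M ↔ ∃ r : L.Relations 2, OrderedBy r M := Iff.rfl

theorem OrderedBy.exists_linearOrder {r : L.Relations 2} {M : Type w} [L.Structure M]
    (h : OrderedBy r M) : ∃ _ : LinearOrder M, InterpretsLE M r := by
  classical
  exact ⟨{ le := fun a b => RelMap r ![a, b]
           le_refl := h.1
           le_trans := h.2.1
           le_antisymm := h.2.2.1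
           le_total := h.2.2.2
           toDecidableLE := Classical.decRel _ }, fun a b => Iff.rfl⟩

theorem OrderedBy.of_embedding {r : L.Relations 2} {M N : Type w} [L.Structure M] [L.Structure N]
    (h : OrderedBy r N) (e : M ↪[L] N) : OrderedBy r M := by
  have key : ∀ a b, RelMap r ![a, b] ↔ RelMap r ![e a, e b] := fun a b => by
    rw [← e.map_rel, show e ∘ ![a, b] = ![e a, e b] from funext fun i => by fin_cases i <;> rfl]
  simp only [OrderedBy, key]
  exact ⟨fun a => h.1 _, fun a b c => h.2.1 _ _ _, fun a b h1 h2 =>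
    e.injective (h.2.2.1 _ _ h1 h2), fun a b => h.2.2.2 _ _⟩

theorem BoundedComponents.mono [L.IsRelational] {C D : Set (Bundled.{w} L.Structure)}
    (h : BoundedComponents L D) (hCD : C ⊆ D) : BoundedComponents L C :=
  h.imp fun _ hN M hM => hN M (hCD hM)

theorem exists_arity_le (L : FirstOrder.Language.{u, v}) [Finite (Σ n, L.Relations n)] :
    ∃ m : ℕ, ∀ (k : ℕ) (_ : L.Relations k), k ≤ m := by
  obtain ⟨m, hm⟩ := (Set.finite_range fun p : Σ n, L.Relations n => p.1).bddAbove
  exact ⟨m, fun k R => hm ⟨⟨k, R⟩, rfl⟩⟩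

section Profile

variable [L.IsRelational] [Finite (Σ n, L.Relations n)] {C : Set (Bundled.{w} L.Structure)}

/-- Heredity makes `B` closed under isomorphism of finite structures, so a type found in both
classes is realised in their intersection. -/
theorem profile_union_add_profile_inter {A B : Set (Bundled.{w} L.Structure)} (hB : Hereditary B)
    (n : ℕ) : profile L (A ∪ B) n + profile L (A ∩ B) n = profile L A n + profile L B n := by
  rw [profile, profile, profile, profile, ← Set.ncard_union_add_ncard_inter _ _
    (finite_isoClasses L A n) (finite_isoClasses L B n), ← Set.image_union]
  congr 2
  · congr 1
    ext M
    simp only [Set.mem_ofPred_eq, Set.mem_union]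
    tauto
  · refine Set.Subset.antisymm ?_ ?_
    · rintro _ ⟨M, ⟨⟨hA, hB⟩, hM⟩, rfl⟩
      exact ⟨⟨M, ⟨hA, hM⟩, rfl⟩, ⟨M, ⟨hB, hM⟩, rfl⟩⟩
    · rintro _ ⟨⟨M, ⟨hMA, hMfin, hMn⟩, rfl⟩, ⟨N, ⟨hNB, -⟩, hNM⟩⟩
      obtain ⟨e⟩ : Nonempty (N ≃[L] M) := Quotient.exact hNM
      exact ⟨M, ⟨⟨hMA, hB N hNB ⟨FG.of_finite, ⟨e.symm.toEmbedding⟩⟩⟩, hMfin, hMn⟩, rfl⟩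

theorem eventuallyPolynomial_profile_of_orderedBy (hC : Hereditary C) (hfin : ∀ M ∈ C, Finite M)
    (hb : BoundedComponents L C) {r : L.Relations 2} (hr : ∀ M ∈ C, OrderedBy r M) :
    EventuallyPolynomial fun n => (profile L C n : ℚ) := by
  obtain ⟨N, hN⟩ := hb
  obtain ⟨m, hm⟩ := exists_arity_le L
  refine eventuallyPolynomial_profile_of_ncard_breaks_lt hC hfin r (N * N * (3 * m + 1) + 1)
    fun M hM => ?_
  have := hfin M hM
  obtain ⟨_, hle⟩ := (hr M hM).exists_linearOrder
  obtain ⟨c, hc⟩ := exists_coloring_of_encard_monomorphicComponents_le (hN M hM)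
  exact ⟨_, hle, Nat.lt_succ_of_le (ncard_breaks_le hle hm hc)⟩

/-- Different members may be ordered by different symbols. Induction on the set of symbols with
inclusion and exclusion reduces to one symbol; the intersection is again covered by the smaller set.
-/
theorem eventuallyPolynomial_profile_of_mem_finset (s : Finset (L.Relations 2)) (hC : Hereditary C)
    (hfin : ∀ M ∈ C, Finite M) (hb : BoundedComponents L C)
    (hs : ∀ M ∈ C, ∃ r ∈ s, OrderedBy r M) :
    EventuallyPolynomial fun n => (profile L C n : ℚ) := by
  classical
  induction s using Finset.induction_on generalizing C with
  | empty =>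
    have : C = ∅ := Set.eq_empty_of_forall_notMem fun M hM => by simpa using hs M hM
    subst this
    simpa [profile] using EventuallyPolynomial.zero
  | insert a s _ ih =>
    let A : Set (Bundled.{w} L.Structure) := {M ∈ C | OrderedBy a M}
    let B : Set (Bundled.{w} L.Structure) := {M ∈ C | ∃ r ∈ s, OrderedBy r M}
    have hA : Hereditary A := fun M hM N hN =>
      ⟨hC M hM.1 hN, hM.2.of_embedding hN.2.some⟩
    have hB : Hereditary B := fun M hM N hN =>
      ⟨hC M hM.1 hN, hM.2.imp fun r hr => ⟨hr.1, hr.2.of_embedding hN.2.some⟩⟩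
    have hAB : A ∪ B = C := by
      refine Set.Subset.antisymm ?_ fun M hM => ?_
      · rintro M (h | h) <;> exact h.1
      · obtain ⟨r, hrs, hr⟩ := hs M hM
        rcases Finset.mem_insert.1 hrs with rfl | hrs
        exacts [Or.inl ⟨hM, hr⟩, Or.inr ⟨hM, r, hrs, hr⟩]
    have hI : Hereditary (A ∩ B) := fun M hM N hN => ⟨hA M hM.1 hN, hB M hM.2 hN⟩
    have h1 := eventuallyPolynomial_profile_of_orderedBy hA (fun M hM => hfin M hM.1)
      (hb.mono fun M hM => hM.1) fun M hM => hM.2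
    have h2 := ih hB (fun M hM => hfin M hM.1) (hb.mono fun M hM => hM.1) fun M hM => hM.2
    have h3 := ih hI (fun M hM => hfin M hM.1.1) (hb.mono fun M hM => hM.1.1) fun M hM => hM.2.2
    refine ((h1.add h2).sub h3).congr (Filter.Eventually.of_forall fun n => ?_)
    rw [eq_sub_iff_add_eq, ← hAB]
    exact_mod_cast profile_union_add_profile_inter hB n

theorem eventuallyPolynomial_profile (hC : Hereditary C)
    (hord : ∀ M ∈ C, Finite M ∧ IsOrdered L M) (hb : BoundedComponents L C) :
    EventuallyPolynomial fun n => (profile L C n : ℚ) := by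
  have : Finite (L.Relations 2) :=
    Finite.of_injective (fun R => (⟨2, R⟩ : Σ n, L.Relations n)) fun R S h => by simpa using h
  have := Fintype.ofFinite (L.Relations 2)
  refine eventuallyPolynomial_profile_of_mem_finset Finset.univ hC (fun M hM => (hord M hM).1) hb
    fun M hM => ?_
  obtain ⟨r, hr⟩ := isOrdered_iff.1 (hord M hM).2
  exact ⟨r, Finset.mem_univ _, hr⟩

/-- If `2 ^ (n / (m + 1))` exceeds the profile at even one `n`, then every member has fewer than `B`
breaks, hence boundedly many components. -/
theorem atLeastExponential_profile (hC : Hereditary C)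
    (hord : ∀ M ∈ C, Finite M ∧ IsOrdered L M) (hb : ¬ BoundedComponents L C) :
    AtLeastExponential (profile L C) := by
  obtain ⟨m, hm⟩ := exists_arity_le L
  refine AtLeastExponential.of_two_pow_le (m + 1) (Nat.succ_pos m) fun n => ?_
  set B := n / (m + 1) * (2 * (2 * m + 1) + 1) + n + n / (m + 1)
  by_contra hlt
  refine hb ⟨B + 1, fun M hM => ?_⟩
  obtain ⟨hfin, r, hr⟩ := hord M hM
  obtain ⟨_, hle⟩ := OrderedBy.exists_linearOrder hr
  have hbr : (breaks L M).ncard < B := by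
    by_contra! h
    exact hlt (two_pow_le_profile hC hM hle hm (Nat.div_mul_le_self n (m + 1)) h)
  obtain ⟨c, hc⟩ := exists_isCanonicalColoring hbr
  exact encard_monomorphicComponents_le_of_coloring hc.same

end Profile

/-! ### Finite decompositions and the age -/

section Age

variable {R : Type w} [L.Structure R]

theorem hereditary_age : Hereditary (L.age R) :=
  fun _ hM _ hN => ⟨hN.1, ⟨hM.2.some.comp hN.2.some⟩⟩

variable [L.IsRelational]

theorem finite_and_isOrdered_of_mem_age (hR : IsOrdered L R) :
    ∀ M ∈ L.age R, Finite M ∧ IsOrdered L M := fun _ hM =>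
  ⟨fg_iff_finite.1 hM.1, hR.imp fun _ hr => OrderedBy.of_embedding hr hM.2.some⟩

theorem boundedComponents_age (h : HasFiniteMonomorphicDecomposition L R) :
    BoundedComponents L (L.age R) := by
  obtain ⟨P, hP, hpart, hblock⟩ := h
  have : Finite P := hP
  choose b hb using fun x => (hpart.2 x).exists
  let c : R → Fin (Nat.card P) := fun x => Finite.equivFin P ⟨b x, (hb x).1⟩
  have hc : ∀ x y, c x = c y → Interchangeable L x y := fun x y hxy => by
    have h : b x = b y := congrArg Subtype.val ((Finite.equivFin P).injective hxy)
    exact isMonomorphicBlock_iff.1 (hblock _ (hb x).1) x (hb x).2 y (h ▸ (hb y).2)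
  refine ⟨Nat.card P + 1, fun M hM => ?_⟩
  obtain ⟨e⟩ := hM.2
  exact encard_monomorphicComponents_le_of_coloring (c := c ∘ e) fun x y hxy =>
    Interchangeable.of_embedding e (hc _ _ hxy)

theorem not_interchangeable_induced {x y : R} (F : Set R) (hx : x ∉ F) (hy : y ∉ F)
    (h : ¬ SameType L (insert x F) (insert y F)) {A : Set R} (hA : A.Finite) (hxA : x ∈ A)
    (hyA : y ∈ A) (hFA : F ⊆ A) :
    ¬ Interchangeable L (⟨x, hxA⟩ : induced L A) (⟨y, hyA⟩ : induced L A) := fun hE => by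
  have : Finite (induced L A) := hA
  have hF : (Subtype.val : induced L A → R) '' (Subtype.val ⁻¹' F) = F := by
    rw [Set.image_preimage_eq_iff]
    exact fun z hz => ⟨⟨z, hFA hz⟩, rfl⟩
  have h1 := (hE (Subtype.val ⁻¹' F) (Set.toFinite _) hx hy).image (induced L A).subtype
  rw [Set.image_insert_eq, Set.image_insert_eq] at h1
  change SameType L (insert x (Subtype.val '' _)) (insert y (Subtype.val '' _)) at h1
  rw [hF] at h1
  exact h h1

/-- Compactness: given `N + 1` pairwise non-interchangeable points, adjoining a finite witness for
each pair yields a finite substructure where they remain so, contradicting the bound `N` on its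
components. -/
theorem hasFiniteMonomorphicDecomposition_of_boundedComponents_age
    (h : BoundedComponents L (L.age R)) : HasFiniteMonomorphicDecomposition L R := by
  classical
  obtain ⟨N, hN⟩ := h
  have hfin : Finite (Quotient (interchangeSetoid L R)) := by
    by_contra hinf
    rw [not_finite_iff_infinite] at hinf
    let q : Fin (N + 1) ↪ Quotient (interchangeSetoid L R) :=
      Fin.valEmbedding.trans (Infinite.natEmbedding _)
    let x : Fin (N + 1) → R := fun i => (q i).out
    have hx : ∀ i j, i ≠ j → ¬ Interchangeable L (x i) (x j) := fun i j hij hE =>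
      hij (q.injective (by
        rw [← Quotient.out_eq (q i), ← Quotient.out_eq (q j)]
        exact Quotient.sound hE))
    have hF : ∀ i j, ∃ F : Set R, F.Finite ∧ (i ≠ j → x i ∉ F ∧ x j ∉ F ∧
        ¬ SameType L (insert (x i) F) (insert (x j) F)) := fun i j => by
      by_cases hij : i = j
      · exact ⟨∅, Set.finite_empty, fun h => absurd hij h⟩
      · have := hx i j hij
        simp only [Interchangeable, not_forall] at this
        obtain ⟨F, hF, h1, h2, h3⟩ := this
        exact ⟨F, hF, fun _ => ⟨h1, h2, h3⟩⟩
    choose F hFfin hF using hF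
    let A : Set R := Set.range x ∪ ⋃ i, ⋃ j, F i j
    have hA : A.Finite := (Set.finite_range x).union
      (Set.finite_iUnion fun i => Set.finite_iUnion fun j => hFfin i j)
    have hxA : ∀ i, x i ∈ A := fun i => Or.inl ⟨i, rfl⟩
    have hFA : ∀ i j, F i j ⊆ A := fun i j z hz =>
      Or.inr (Set.mem_iUnion.2 ⟨i, Set.mem_iUnion.2 ⟨j, hz⟩⟩)
    have : Finite (induced L A) := hA
    obtain ⟨c, hc⟩ := exists_coloring_of_encard_monomorphicComponents_le
      (hN ⟨induced L A, inferInstance⟩ ⟨FG.of_finite, ⟨(induced L A).subtype⟩⟩)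
    have hinj : Function.Injective fun i => c ⟨x i, hxA i⟩ := fun i j hij => by
      by_contra hne
      obtain ⟨h1, h2, h3⟩ := hF i j hne
      exact not_interchangeable_induced (F i j) h1 h2 h3 hA (hxA i) (hxA j) (hFA i j)
        (hc _ _ hij)
    have := Fintype.card_le_of_injective _ hinj
    simp at this
  refine ⟨(interchangeSetoid L R).classes, ?_, Setoid.isPartition_classes _, ?_⟩
  · exact Finite.of_equiv _ (Setoid.quotientEquivClasses (interchangeSetoid L R))
  · rintro _ ⟨x, rfl⟩
    exact isMonomorphicBlock_iff.2 fun y hy z hz =>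
      Interchangeable.trans hy (Interchangeable.symm hz)

end Age

end Classes

end OrderedProfile

theorem mainTheorem1 (L : FirstOrder.Language.{u, v}) [L.IsRelational]
    [Finite (Σ n, L.Relations n)] :
    (∀ (R : Type w) [L.Structure R], OrderedProfile.IsOrdered L R →
      (OrderedProfile.HasFiniteMonomorphicDecomposition L R →
        OrderedProfile.EventuallyQuasiPolynomial (OrderedProfile.profile L (L.age R))) ∧
      (¬ OrderedProfile.HasFiniteMonomorphicDecomposition L R →
        OrderedProfile.AtLeastExponential (OrderedProfile.profile L (L.age R)))) ∧
    (∀ C : Set (Bundled.{w} L.Structure),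
      FirstOrder.Language.Hereditary C →
      (∀ M ∈ C, Finite M ∧ OrderedProfile.IsOrdered L M) →
      ((OrderedProfile.BoundedComponents L C ∧
          OrderedProfile.EventuallyQuasiPolynomial (OrderedProfile.profile L C)) ∨
        (¬ OrderedProfile.BoundedComponents L C ∧
          OrderedProfile.AtLeastExponential (OrderedProfile.profile L C))) ∧
      (¬ OrderedProfile.PolynomiallyBounded (OrderedProfile.profile L C) →
        OrderedProfile.AtLeastExponential (OrderedProfile.profile L C))) := by
  open OrderedProfile in
  refine ⟨fun R _ hR => ⟨fun h => ?_, fun h => ?_⟩, fun C hC hord => ?_⟩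
  · exact (eventuallyPolynomial_profile hereditary_age (finite_and_isOrdered_of_mem_age hR)
      (boundedComponents_age h)).eventuallyQuasiPolynomial
  · exact atLeastExponential_profile hereditary_age (finite_and_isOrdered_of_mem_age hR)
      fun hb => h (hasFiniteMonomorphicDecomposition_of_boundedComponents_age hb)
  · by_cases hb : BoundedComponents L C
    · have hp := eventuallyPolynomial_profile hC hord hb
      exact ⟨Or.inl ⟨hb, hp.eventuallyQuasiPolynomial⟩, fun h => absurd hp.polynomiallyBounded h⟩
    · have he := atLeastExponential_profile hC hord hb
      exact ⟨Or.inr ⟨hb, he⟩, fun _ => he⟩
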